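/- **Theorem 9.1.** Let $n\ge 2$ and let $\hat S_n$ be the affine symmetric group with generators $s_i$, $i\in\mathbb Z/n$ (for $n=2$ the infinite dihedral group), let $\rho$ be its automorphism $s_i\mapsto s_{i+1}$, and let $\phi:\hat S_n\to S_n$ be the homomorphism with $\phi(s_i)=(i\ \ i+1)$, positions being taken modulo $n$. An element $g$ is a *glide* of offset $k$ if $\phi(g)$ is the rotation $p\mapsto p+k$. Let $u=s_{i_1}\cdots s_{i_l}$ (the state word) and $v=s_{j_1}\cdots s_{j_m}$ (the carrier word) be words representing glides of offsets $k_1$ and $k_2$, such that the concatenated word $vu$ is reduced. For $\mathbf z\in(\mathbb R_{>0})^m$ (a carrier) and $\mathbf y\in(\mathbb R_{>0})^l$ (a state) write $F(\mathbf z,\mathbf y)=(\mathbf y',\mathbf z')$ if the weighted word $$s_{j_1}(z_1)\cdots s_{j_m}(z_m)\,s_{i_1}(y_1)\cdots s_{i_l}(y_l)$$ can be transformed into $$s_{i_1+k_2}(y_1')\cdots s_{i_l+k_2}(y_l')\,s_{j_1-k_1}(z_1')\cdots s_{j_m-k_1}(z_m')$$ by the moves $s_i(a)s_j(b)s_i(c)\to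 s_j\!\left(\tfrac{bc}{a+c}\right)s_i(a+c)\,s_j\!\left(\tfrac{ab}{a+c}\right)$ (for $n\ge3$ and $i-j\equiv\pm1 \pmod n$) and $s_i(a)s_j(b)\to s_j(b)s_i(a)$ (for $i-j\not\equiv0,\pm1 \pmod n$). Draw the wiring diagram of $vu$ on a cylinder with $n$ wires, each letter $s_i$ being a crossing of the wires in positions $i$ and $i+1$, and assume that every pair of wires that crosses in this diagram crosses at least once in its $u$ portion. Then affine dKdV with state word $u$ and carrier word $v$ admits a carrier-free description: there are $r\ge0$ and a map $G:\big((\mathbb R_{>0})^{l}\big)^{r+1}\to(\mathbb R_{>0})^{l}$, depending only on the words $u$ and $v$, with the following properties. 1. For all sequences $(\mathbf y_i)_{i\in\mathbb Z}$, $(\mathbf y'_i)_{i\in\mathbb Z}$ of states, there are carriers $(\mathbf z_i)_{i\in\mathbb Z}$ with $F(\mathbf z_i,\mathbf y_i)=(\mathbf y_i',\mathbf z_{i+1})$ for all $i$ if and only if $\mathbf y'_i=G(\mathbf y_{i-r},\dots,\mathbf y_{i-1},\mathbf y_i)$ for all $i$. 2. For every vacuum $\mathbf w\in(\mathbb R_{>0})^l$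 and initial carrier $\mathbf z_{-\infty}\in(\mathbb R_{>0})^m$ with $F(\mathbf z_{-\infty},\mathbf w)=(\mathbf w,\mathbf z_{-\infty})$, every state sequence $(\mathbf y_i)$ with $\lim_{i\to\pm\infty}\mathbf y_i=\mathbf w$, and every state sequence $(\mathbf y'_i)$: $(\mathbf y'_i)$ is the result of one time step of affine dKdV applied to $(\mathbf y_i)$, that is, there are carriers $\mathbf z_i$ with $\lim_{i\to-\infty}\mathbf z_i=\mathbf z_{-\infty}$ and $F(\mathbf z_i,\mathbf y_i)=(\mathbf y'_i,\mathbf z_{i+1})$ for all $i\in\mathbb Z$, if and only if $\mathbf y'_i=G(\mathbf y_{i-r},\dots,\mathbf y_i)$ for all $i$. In particular the new state $\mathbf y'_i$ depends only on the finite window $\mathbf y_{i-r},\dots,\mathbf y_i$, and not on the initial carrier. -/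

import Mathlib

open Filter Topology

namespace AffineDKdV

/-- The Coxeter matrix of the affine symmetric group on the generators `s_i`, `i ∈ ℤ/n`:
`s_i s_j` has order `3` if `i - j = ±1` and order `2` if `i - j ≠ 0, ±1`.  As usual, for `n = 2`
the two generators satisfy no braid relation (entry `0`, i.e. infinite order): the group is then
the infinite dihedral group. -/
def affineMatrix (n : ℕ) : CoxeterMatrix (ZMod n) where
  M := Matrix.of fun i j : ZMod n =>
    if i = j then 1 else if i = j + 1 ∨ j = i + 1 then (if n = 2 then 0 else 3) else 2
  isSymm := by
    ext i j
    simp only [Matrix.transpose_apply, Matrix.of_apply, eq_comm (a := j) (b := i),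
      or_comm (a := j = i + 1)]
  diagonal := by simp
  off_diagonal := by
    intro i j h
    simp only [Matrix.of_apply, if_neg h]
    split_ifs <;> simp

/-- The affine symmetric group, by generators and relations. -/
abbrev AffineSym (n : ℕ) : Type := (affineMatrix n).Group

/-- The affine symmetric group with its simple generators; it provides the product
`coxeter.wordProd` of a word, and the notion `coxeter.IsReduced` of a reduced word. -/
abbrev coxeter (n : ℕ) : CoxeterSystem (affineMatrix n) (AffineSym n) :=
  (affineMatrix n).toCoxeterSystem

theorem isLiftable_swap (n : ℕ) :
    (affineMatrix n).IsLiftable fun i : ZMod n => Equiv.swap i (i + 1) := by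
  have key : ∀ i : ZMod n, (2 : ZMod n) ≠ 0 →
      (Equiv.swap i (i + 1) * Equiv.swap (i + 1) (i + 1 + 1)) ^ 3 = 1 := by
    intro i h2
    have h1 : (1 : ZMod n) ≠ 0 := by
      intro h
      exact h2 (by rw [← one_add_one_eq_two, h, add_zero])
    have h02 : i ≠ i + 1 + 1 := by
      intro h
      apply h2
      rw [add_assoc, one_add_one_eq_two] at h
      simpa using h.symm
    have h01 : i ≠ i + 1 := by simpa using h1
    have h12 : i + 1 ≠ i + 1 + 1 := by simpa using h1
    generalize i + 1 + 1 = c at *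
    generalize i + 1 = b at *
    ext x
    simp only [pow_succ, pow_zero, one_mul, Equiv.Perm.mul_apply, Equiv.Perm.one_apply]
    by_cases hb : x = b
    · subst hb
      rw [Equiv.swap_apply_left, Equiv.swap_apply_of_ne_of_ne h02.symm h12.symm,
        Equiv.swap_apply_right, Equiv.swap_apply_right, Equiv.swap_apply_of_ne_of_ne h01 h02,
        Equiv.swap_apply_left]
    · by_cases hc : x = c
      · subst hc
        rw [Equiv.swap_apply_right, Equiv.swap_apply_right, Equiv.swap_apply_of_ne_of_ne h01 h02,
          Equiv.swap_apply_left, Equiv.swap_apply_left,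
          Equiv.swap_apply_of_ne_of_ne h02.symm h12.symm]
      · by_cases ha : x = i
        · subst ha
          rw [Equiv.swap_apply_of_ne_of_ne h01 h02, Equiv.swap_apply_left, Equiv.swap_apply_left,
            Equiv.swap_apply_of_ne_of_ne h02.symm h12.symm, Equiv.swap_apply_right,
            Equiv.swap_apply_right]
        · rw [Equiv.swap_apply_of_ne_of_ne hb hc, Equiv.swap_apply_of_ne_of_ne ha hb,
            Equiv.swap_apply_of_ne_of_ne hb hc, Equiv.swap_apply_of_ne_of_ne ha hb,
            Equiv.swap_apply_of_ne_of_ne hb hc, Equiv.swap_apply_of_ne_of_ne ha hb]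
  have two_ne : ∀ i : ZMod n, i ≠ i + 1 → n ≠ 2 → (2 : ZMod n) ≠ 0 := by
    intro i hi hn h
    have hd : n ∣ 2 := by
      rw [← CharP.cast_eq_zero_iff (ZMod n) n 2]
      exact_mod_cast h
    rcases (Nat.dvd_prime Nat.prime_two).1 hd with h' | h'
    · subst h'
      exact hi (Subsingleton.elim _ _)
    · exact hn h'
  intro i j
  simp only [affineMatrix, Matrix.of_apply]
  split_ifs with h h' h''
  · subst h; simp
  · simp
  · rcases h' with h' | h'
    · subst h'
      have hk := key j (two_ne j (Ne.symm h) h'')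
      have : Equiv.swap (j + 1) (j + 1 + 1) * Equiv.swap j (j + 1)
          = (Equiv.swap j (j + 1) * Equiv.swap (j + 1) (j + 1 + 1))⁻¹ := by
        simp [mul_inv_rev]
      rw [this, inv_pow, hk, inv_one]
    · subst h'
      exact key i (two_ne i h h'')
  · push Not at h'
    have hd : Equiv.Perm.Disjoint (Equiv.swap i (i + 1)) (Equiv.swap j (j + 1)) := by
      intro x
      by_cases hx : x = i ∨ x = i + 1
      · right
        apply Equiv.swap_apply_of_ne_of_ne
        · rcases hx with rfl | rfl
          · exact h
          · exact fun e => h'.2 e.symm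
        · rcases hx with rfl | rfl
          · exact h'.1
          · exact fun e => h (add_right_cancel e)
      · push Not at hx
        exact Or.inl (Equiv.swap_apply_of_ne_of_ne hx.1 hx.2)
    rw [pow_two, ← mul_assoc, mul_assoc (Equiv.swap i (i + 1)), ← hd.commute.eq]
    simp

/-- The homomorphism `φ` from the affine symmetric group to the permutations of the `n` positions
(indexed by `ℤ/n`, position `n` being `0`), with `φ (s_i) = (i  i+1)`, so `φ (s_0) = (n  1)`. -/
def toPerm (n : ℕ) : AffineSym n →* Equiv.Perm (ZMod n) :=
  (coxeter n).lift ⟨fun i => Equiv.swap i (i + 1), isLiftable_swap n⟩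

/-- `g` is a glide of offset `k`: `φ (g)` is the rotation `p ↦ p + k` of the positions. -/
def IsGlide {n : ℕ} (g : AffineSym n) (k : ZMod n) : Prop :=
  ∀ p : ZMod n, toPerm n g p = p + k

/-- In the wiring diagram of the word `a ++ i :: b`, the wire that is in position `p` at the right
end of the diagram is in position `φ (b) p` just to the right of the crossing given by the letter
`i`, and that crossing exchanges the wires in positions `i` and `i + 1`.  Wires are labelled by
their positions at the right end; `WiresCross w p q` says that the wires `p` and `q` cross at
least once in the diagram of `w`. -/
def WiresCross {n : ℕ} (w : List (ZMod n)) (p q : ZMod n) : Prop :=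
  ∃ (a : List (ZMod n)) (i : ZMod n) (b : List (ZMod n)), w = a ++ i :: b ∧
    s(toPerm n ((coxeter n).wordProd b) p, toPerm n ((coxeter n).wordProd b) q) = s(i, i + 1)

/-- The positive real numbers. -/
abbrev PosReal : Type := {x : ℝ // 0 < x}

/-- A choice of one positive weight for each letter of the word `w`.  A state is an element of
`Weights u` for the state word `u`, a carrier one of `Weights v` for the carrier word `v`. -/
abbrev Weights {n : ℕ} (w : List (ZMod n)) : Type := Fin w.length → PosReal

/-- The weighted word `s_{i_1 + k}(y_1) ⋯ s_{i_l + k}(y_l)`, where `w = s_{i_1} ⋯ s_{i_l}`. -/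
def weightedWord {n : ℕ} (w : List (ZMod n)) (k : ZMod n) (y : Weights w) :
    List (ZMod n × PosReal) :=
  List.ofFn fun t : Fin w.length => (w.get t + k, y t)

/-- One application of a Lusztig relation inside a weighted word. -/
inductive LusztigMove (n : ℕ) : List (ZMod n × PosReal) → List (ZMod n × PosReal) → Prop
  | braid (A B : List (ZMod n × PosReal)) (i j : ZMod n) (a b c : PosReal)
      (h : affineMatrix n i j = 3) :
      LusztigMove n (A ++ [(i, a), (j, b), (i, c)] ++ B)
        (A ++ [(j, b * c / (a + c)), (i, a + c), (j, a * b / (a + c))] ++ B)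
  | comm (A B : List (ZMod n × PosReal)) (i j : ZMod n) (a b : PosReal)
      (h : affineMatrix n i j = 2) :
      LusztigMove n (A ++ [(i, a), (j, b)] ++ B) (A ++ [(j, b), (i, a)] ++ B)

/-- The interaction `F_{v,u} (z, y) = (y', z')` of the carrier `z` with the state `y`, where `k₁`
and `k₂` are the offsets of the glides `u` and `v`: Lusztig relations transform the weighting
`(z, y)` of the word `v u` into the weighting `(y', z')` of the word `ρ^{k₂}(u) ρ^{-k₁}(v)`. -/
def Interaction {n : ℕ} (u v : List (ZMod n)) (k₁ k₂ : ZMod n)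
    (z : Weights v) (y : Weights u) (y' : Weights u) (z' : Weights v) : Prop :=
  Relation.ReflTransGen (LusztigMove n)
    (weightedWord v 0 z ++ weightedWord u 0 y)
    (weightedWord u k₂ y' ++ weightedWord v (-k₁) z')

/-- The carriers `z i` sweep through all the states `y i` from left to right and turn them into
the states `y' i`: `F_{v,u} (z_i, y_i) = (y'_i, z_{i+1})` for all `i ∈ ℤ`. -/
def Sweep {n : ℕ} (u v : List (ZMod n)) (k₁ k₂ : ZMod n)
    (z : ℤ → Weights v) (y y' : ℤ → Weights u) : Prop :=
  ∀ i : ℤ, Interaction u v k₁ k₂ (z i) (y i) (y' i) (z (i + 1))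

/-- One step of the time evolution of affine dKdV with initial carrier `z₀`: the carrier starts
as `z₀` at `-∞` and sweeps through the state sequence `y`; the resulting state sequence is `y'`. -/
def Evolves {n : ℕ} (u v : List (ZMod n)) (k₁ k₂ : ZMod n) (z₀ : Weights v)
    (y y' : ℤ → Weights u) : Prop :=
  ∃ z : ℤ → Weights v, Tendsto z atBot (𝓝 z₀) ∧ Sweep u v k₁ k₂ z y y'

/-- The sequence `y'` is computed from `y` by the local rule `G`:
`y'_i = G (y_{i-r}, …, y_{i-1}, y_i)` for all `i ∈ ℤ`. -/
def IsGivenBy {n : ℕ} {u : List (ZMod n)} {r : ℕ} (G : (Fin (r + 1) → Weights u) → Weights u)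
    (y y' : ℤ → Weights u) : Prop :=
  ∀ i : ℤ, y' i = G fun t => y (i - r + ((t : ℕ) : ℤ))

end AffineDKdV

open AffineDKdV

/-!
A glide shifts the integers of each residue `p` modulo `n` by a constant, its displacement
(`disp`), so that glides behave like translations. If `v u` is reduced, the displacements of `v` are
weakly ordered like those of `u` (`disp_le_of_noDoubleCross`); if moreover all wires that cross in
`v u` cross in `u`, then wires with equal displacement in `u` have equal displacement in `v`
(`disp_eq_of_wiresCross`). Hence the inversions of `v` are among those of a long product
`u ρ^{-k₁}(u) ⋯ ρ^{-(N-1)k₁}(u)`, and this product has a reduced word `W v'`, where `v'` is the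
shifted carrier word (`GlidePair.exists_word_before_carrier`).

Let `N` consecutive states form a weighting of the product. Lusztig moves turn it into a weighting
of `W v'`, whose last part `Z (y_1, …, y_N)` is a carrier that depends continuously on the states. A
carrier that sweeps through the `N` states also ends up as a weighting of `v'`, at the end of a
reduced word for the same element. Weights of a reduced word are determined by the matrix that the
weighted word represents, which the moves preserve (`weights_eq_of_columns_eq`), so the swept
carrier equals `Z (y_1, …, y_N)`, whatever it was before (`GlidePair.carrier_of_sweep`).
The new state is computed from this carrier and the current state, so it depends on `N + 1` states.
Conversely the carriers `Z (y_{i-N}, …, y_{i-1})` form a sweep (`GlidePair.interaction_carrier`),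
again by uniqueness of weights. Under the boundary condition of the time evolution they converge
by continuity of `Z` to its value on the constant vacuum, which is the given initial carrier.

Two facts about the affine symmetric group are proved on the way, through its action on `ℤ`:
Matsumoto's theorem (`CrossRed.moveEquiv`), which provides the moves, and the fact that a reduced
word never turns back a pair of integers that it has turned around (`crossRed_of_isReduced`,
`NoDoubleCross.of_crossRed`).
-/

namespace AffineDKdV

/-! ### Affine permutations of words -/

/-- The affine transposition `s_i` as a map `ℤ → ℤ`: it exchanges `x` and `x + 1` for every
`x ≡ i` modulo `n`. -/
def affSwap {n : ℕ} (i : ZMod n) (x : ℤ) : ℤ :=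
  if (x : ZMod n) = i then x + 1 else if (x : ZMod n) = i + 1 then x - 1 else x

/-- The affine permutation of `ℤ` represented by a word; the last letter acts first. -/
def affPerm {n : ℕ} (w : List (ZMod n)) (x : ℤ) : ℤ := w.foldr affSwap x

variable {n : ℕ}

@[simp] theorem affPerm_nil (x : ℤ) : affPerm ([] : List (ZMod n)) x = x := rfl

@[simp] theorem affPerm_cons (i : ZMod n) (w : List (ZMod n)) (x : ℤ) :
    affPerm (i :: w) x = affSwap i (affPerm w x) := rfl

@[simp] theorem affPerm_append (w w' : List (ZMod n)) (x : ℤ) :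
    affPerm (w ++ w') x = affPerm w (affPerm w' x) := by
  simp [affPerm]

theorem affSwap_shift (i k : ZMod n) (x m : ℤ) (hm : (m : ZMod n) = k) :
    affSwap (i + k) (x + m) = affSwap i x + m := by
  have h : i + k + 1 = (i + 1) + k := by ring
  simp only [affSwap, Int.cast_add, hm, add_left_inj, h]
  split_ifs <;> ring

theorem affPerm_shift (w : List (ZMod n)) (k : ZMod n) (x m : ℤ) (hm : (m : ZMod n) = k) :
    affPerm (w.map (· + k)) (x + m) = affPerm w x + m := by
  induction w with
  | nil => rfl
  | cons i w ih => simp [ih, affSwap_shift i k _ m hm]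

theorem affPerm_add (w : List (ZMod n)) (x m : ℤ) (hm : (m : ZMod n) = 0) :
    affPerm w (x + m) = affPerm w x + m := by
  simpa using affPerm_shift w 0 x m hm

theorem affPerm_map_add_congr {w w' : List (ZMod n)} (h : affPerm w = affPerm w') (k : ZMod n) :
    affPerm (w.map (· + k)) = affPerm (w'.map (· + k)) := by
  obtain ⟨m, hm⟩ := ZMod.intCast_surjective k
  funext x
  rw [← sub_add_cancel x m, affPerm_shift w k _ m hm, affPerm_shift w' k _ m hm, h]

theorem affPerm_lt_succ_of_eq (w : List (ZMod n)) {x y : ℤ} (h : (x : ZMod n) = y)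
    (hx : affPerm w x < affPerm w (x + 1)) : affPerm w y < affPerm w (y + 1) := by
  have e : ((y - x : ℤ) : ZMod n) = 0 := by simp [h]
  have h1 := affPerm_add w x (y - x) e
  have h2 := affPerm_add w (x + 1) (y - x) e
  rw [show x + (y - x) = y by ring] at h1
  rw [show x + 1 + (y - x) = y + 1 by ring] at h2
  omega

theorem affSwap_of_eq {i : ZMod n} {x : ℤ} (h : (x : ZMod n) = i) : affSwap i x = x + 1 := by
  simp [affSwap, h]

theorem affSwap_of_ne_of_ne {i : ZMod n} {x : ℤ} (h : (x : ZMod n) ≠ i)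
    (h' : (x : ZMod n) ≠ i + 1) : affSwap i x = x := by
  simp [affSwap, h, h']

/-- The only adjacent pairs that `s_i` turns around are the pairs `x, x + 1` with `x ≡ i`. -/
theorem eq_succ_of_affSwap_lt {i : ZMod n} {x y : ℤ} (hxy : x < y)
    (h : affSwap i y < affSwap i x) : y = x + 1 ∧ (x : ZMod n) = i := by
  have hy : affSwap i y ≥ y - 1 := by unfold affSwap; split_ifs <;> omega
  have hx : affSwap i x ≤ x + 1 := by unfold affSwap; split_ifs <;> omega
  have e : y = x + 1 := by omega
  refine ⟨e, ?_⟩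
  by_contra hne
  have hx' : affSwap i x ≤ x := by unfold affSwap; split_ifs <;> omega
  have hy' : affSwap i y ≥ y := by
    have : (y : ZMod n) ≠ i + 1 := by simpa [e] using hne
    unfold affSwap; simp only [this, if_false]; split_ifs <;> omega
  omega

/-! ### Words without double crossings, and moves between words -/

/-- A word is crossing-reduced if each of its letters exchanges two values that stand in
increasing order in the affine permutation of the preceding letters. This is reducedness,
expressed through affine permutations. -/
def CrossRed (w : List (ZMod n)) : Prop :=
  ∀ a i b, w = a ++ i :: b → ∀ x : ℤ, (x : ZMod n) = i → affPerm a x < affPerm a (x + 1)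

theorem crossRed_nil : CrossRed ([] : List (ZMod n)) := by
  intro a i b h; simp at h

theorem CrossRed.of_append {w w' : List (ZMod n)} (h : CrossRed (w ++ w')) : CrossRed w := by
  intro a i b e
  exact h a i (b ++ w') (by simp [e])

theorem crossRed_snoc {w : List (ZMod n)} {i : ZMod n} :
    CrossRed (w ++ [i]) ↔
      CrossRed w ∧ ∀ x : ℤ, (x : ZMod n) = i → affPerm w x < affPerm w (x + 1) := by
  refine ⟨fun h => ⟨h.of_append, h w i [] rfl⟩, fun ⟨h1, h2⟩ a j b e => ?_⟩
  rcases List.eq_nil_or_concat b with rfl | ⟨b', c, rfl⟩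
  · obtain ⟨rfl, h⟩ := List.append_inj' e rfl
    simp only [List.cons.injEq, and_true] at h
    subst h
    exact h2
  · have e' : w ++ [i] = (a ++ j :: b') ++ [c] := by simpa using e
    exact h1 a j b' (List.append_inj' e' rfl).1

theorem CrossRed.shift {w : List (ZMod n)} (h : CrossRed w) (k : ZMod n) :
    CrossRed (w.map (· + k)) := by
  induction w using List.reverseRecOn with
  | nil => exact crossRed_nil
  | append_singleton w i ih =>
    rw [crossRed_snoc] at h
    simp only [List.map_append, List.map_cons, List.map_nil]
    refine crossRed_snoc.2 ⟨ih h.1, fun x hx => ?_⟩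
    obtain ⟨m, hm⟩ := ZMod.intCast_surjective k
    have h1 := affPerm_shift w k (x - m) m hm
    have h2 := affPerm_shift w k (x - m + 1) m hm
    have h3 := h.2 (x - m) (by simp [hx, hm])
    rw [show x - m + m = x by ring] at h1
    rw [show x - m + 1 + m = x + 1 by ring] at h2
    omega

theorem CrossRed.snoc {w : List (ZMod n)} (h : CrossRed w) {i : ZMod n} {x : ℤ}
    (hx : (x : ZMod n) = i) (hlt : affPerm w x < affPerm w (x + 1)) : CrossRed (w ++ [i]) :=
  crossRed_snoc.2 ⟨h, fun _ hy => affPerm_lt_succ_of_eq w (hx.trans hy.symm) hlt⟩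

/-- Pairs that `g` turns around are not turned back by `f`. -/
def NoDoubleCross (f g : ℤ → ℤ) : Prop :=
  ∀ x y : ℤ, x < y → g y < g x → f (g y) < f (g x)

/-- One braid or commutation move between words. -/
inductive WordMove (n : ℕ) : List (ZMod n) → List (ZMod n) → Prop
  | braid (a b : List (ZMod n)) (i j : ZMod n) (h : affineMatrix n i j = 3) :
      WordMove n (a ++ [i, j, i] ++ b) (a ++ [j, i, j] ++ b)
  | comm (a b : List (ZMod n)) (i j : ZMod n) (h : affineMatrix n i j = 2) :
      WordMove n (a ++ [i, j] ++ b) (a ++ [j, i] ++ b)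

/-- Two words are move-equivalent if braid and commutation moves lead from one to the other. -/
abbrev MoveEquiv (n : ℕ) : List (ZMod n) → List (ZMod n) → Prop :=
  Relation.ReflTransGen (WordMove n)

theorem MoveEquiv.append_right {w w' : List (ZMod n)} (h : MoveEquiv n w w')
    (b : List (ZMod n)) : MoveEquiv n (w ++ b) (w' ++ b) := by
  refine Relation.ReflTransGen.lift (p := WordMove n) (· ++ b) (fun x y hxy => ?_) _ _ h
  cases hxy with
  | braid a b' i j h => simpa [Function.onFun] using WordMove.braid a (b' ++ b) i j h
  | comm a b' i j h => simpa [Function.onFun] using WordMove.comm a (b' ++ b) i j h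

theorem MoveEquiv.length_eq {w w' : List (ZMod n)} (h : MoveEquiv n w w') :
    w.length = w'.length := by
  induction h with
  | refl => rfl
  | tail _ h ih => rw [ih]; cases h <;> simp

theorem MoveEquiv.wordProd_eq {w w' : List (ZMod n)} (h : MoveEquiv n w w') :
    (coxeter n).wordProd w = (coxeter n).wordProd w' := by
  induction h with
  | refl => rfl
  | tail _ h ih =>
    rw [ih]
    cases h with
    | braid a b i j h =>
      have := (coxeter n).wordProd_braidWord_eq i j
      simp only [CoxeterSystem.braidWord] at this
      rw [h, (affineMatrix n).symmetric j i, h] at this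
      simp [CoxeterSystem.alternatingWord] at this
      rw [CoxeterSystem.wordProd_append, CoxeterSystem.wordProd_append, ← this,
        ← CoxeterSystem.wordProd_append, ← CoxeterSystem.wordProd_append]
    | comm a b i j h =>
      have := (coxeter n).wordProd_braidWord_eq i j
      simp only [CoxeterSystem.braidWord] at this
      rw [h, (affineMatrix n).symmetric j i, h] at this
      simp [CoxeterSystem.alternatingWord] at this
      rw [CoxeterSystem.wordProd_append, CoxeterSystem.wordProd_append, this,
        ← CoxeterSystem.wordProd_append, ← CoxeterSystem.wordProd_append]

/-! ### Affine permutations for `n ≥ 2` -/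

section
variable [Fact (1 < n)]

theorem affSwap_succ_of_eq {i : ZMod n} {x : ℤ} (h : (x : ZMod n) = i) :
    affSwap i (x + 1) = x := by
  simp [affSwap, h]

theorem affSwap_of_eq_succ {i : ZMod n} {x : ℤ} (h : (x : ZMod n) = i + 1) :
    affSwap i x = x - 1 := by
  simp [affSwap, h]

@[simp] theorem affSwap_affSwap (i : ZMod n) (x : ℤ) : affSwap i (affSwap i x) = x := by
  by_cases h : (x : ZMod n) = i
  · rw [affSwap_of_eq h, affSwap_succ_of_eq h]
  · by_cases h' : (x : ZMod n) = i + 1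
    · rw [affSwap_of_eq_succ h', affSwap_of_eq (by simp [h'])]
      ring
    · rw [affSwap_of_ne_of_ne h h', affSwap_of_ne_of_ne h h']

theorem affSwap_lt_affSwap {i : ZMod n} {x y : ℤ} (hxy : x < y)
    (h : ¬ (y = x + 1 ∧ (x : ZMod n) = i)) : affSwap i x < affSwap i y := by
  rcases lt_trichotomy (affSwap i x) (affSwap i y) with h1 | h1 | h1
  · exact h1
  · have := congrArg (affSwap i) h1
    simp only [affSwap_affSwap] at this
    omega
  · exact absurd (eq_succ_of_affSwap_lt hxy h1) h

@[simp] theorem affPerm_reverse_affPerm (w : List (ZMod n)) (x : ℤ) :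
    affPerm w.reverse (affPerm w x) = x := by
  induction w with
  | nil => rfl
  | cons i w ih => simp [ih]

@[simp] theorem affPerm_affPerm_reverse (w : List (ZMod n)) (x : ℤ) :
    affPerm w (affPerm w.reverse x) = x := by
  simpa using affPerm_reverse_affPerm w.reverse x

theorem affPerm_injective (w : List (ZMod n)) : Function.Injective (affPerm w) :=
  Function.LeftInverse.injective (affPerm_reverse_affPerm w)

theorem affPerm_append_right_cancel {a b c : List (ZMod n)}
    (h : affPerm (a ++ c) = affPerm (b ++ c)) : affPerm a = affPerm b := by
  funext x
  simpa using congrFun h (affPerm c.reverse x)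

theorem affSwap_comm {i j : ZMod n} (h : affineMatrix n i j = 2) (x : ℤ) :
    affSwap i (affSwap j x) = affSwap j (affSwap i x) := by
  have h1 : i ≠ j ∧ i ≠ j + 1 ∧ j ≠ i + 1 := by
    simp only [affineMatrix, Matrix.of_apply] at h
    split_ifs at h <;> simp_all
  obtain ⟨h1, h2, h3⟩ := h1
  have h4 : i + 1 ≠ j + 1 := by simpa using h1
  by_cases a : (x : ZMod n) = i
  · rw [affSwap_of_ne_of_ne (i := j) (by rwa [a]) (by rwa [a]), affSwap_of_eq a,
      affSwap_of_ne_of_ne (by simpa [a] using h3.symm) (by simpa [a] using h1)]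
  by_cases b : (x : ZMod n) = j
  · rw [affSwap_of_ne_of_ne (x := x) (i := i) a (by rwa [b]), affSwap_of_eq b,
      affSwap_of_ne_of_ne (by simpa [b] using h2.symm) (by simpa [b] using h1.symm)]
  by_cases c : (x : ZMod n) = i + 1
  · rw [affSwap_of_ne_of_ne (i := j) (by rw [c]; exact h3.symm) (by rwa [c]),
      affSwap_of_eq_succ c,
      affSwap_of_ne_of_ne (by simpa [c] using h1) (by simpa [c] using h2)]
  by_cases d : (x : ZMod n) = j + 1
  · rw [affSwap_of_ne_of_ne (x := x) (i := i) a c, affSwap_of_eq_succ d,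
      affSwap_of_ne_of_ne (by simpa [d] using h1.symm) (by simpa [d] using h3)]
  · rw [affSwap_of_ne_of_ne b d, affSwap_of_ne_of_ne a c, affSwap_of_ne_of_ne b d]

theorem add_one_add_one_ne (hn : n ≠ 2) (i : ZMod n) : i + 1 + 1 ≠ i := by
  intro h
  rw [add_assoc, add_eq_left, one_add_one_eq_two] at h
  have hd : n ∣ 2 := by
    rw [← CharP.cast_eq_zero_iff (ZMod n) n 2]
    exact_mod_cast h
  have := Nat.le_of_dvd two_pos hd
  have := (Fact.out : 1 < n)
  omega

theorem affSwap_braid {i j : ZMod n} (h : affineMatrix n i j = 3) (x : ℤ) :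
    affSwap i (affSwap j (affSwap i x)) = affSwap j (affSwap i (affSwap j x)) := by
  obtain ⟨hij, hadj, hn⟩ : i ≠ j ∧ (i = j + 1 ∨ j = i + 1) ∧ n ≠ 2 := by
    simp only [affineMatrix, Matrix.of_apply] at h
    split_ifs at h <;> simp_all
  wlog hj : j = i + 1 generalizing i j
  · exact (this (by rwa [(affineMatrix n).symmetric]) hij.symm hadj.symm
      (hadj.resolve_right hj)).symm
  subst hj
  have h2 := add_one_add_one_ne hn
  by_cases a : (x : ZMod n) = i
  · rw [affSwap_of_eq a, affSwap_of_eq (i := i + 1) (x := x + 1) (by simp [a]),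
      affSwap_of_ne_of_ne (i := i + 1) (x := x) (by simp [a])
        (by rw [a]; exact (h2 i).symm), affSwap_of_eq a,
      affSwap_of_eq (i := i + 1) (x := x + 1) (by simp [a]),
      affSwap_of_ne_of_ne (by simpa [a] using h2 i) (by simp [a])]
  by_cases b : (x : ZMod n) = i + 1
  · rw [affSwap_of_eq_succ b, affSwap_of_ne_of_ne (i := i + 1) (x := x - 1) (by simp [b])
        (by simpa [b] using (h2 i).symm), affSwap_of_eq (by simp [b]),
      affSwap_of_eq b, affSwap_of_ne_of_ne (i := i) (by simpa [b] using h2 i)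
        (by simp [b]), affSwap_succ_of_eq b]
    ring
  by_cases c : (x : ZMod n) = i + 1 + 1
  · rw [affSwap_of_ne_of_ne a b, affSwap_of_eq_succ c, affSwap_of_eq_succ (by simp [c]),
      affSwap_of_ne_of_ne (i := i + 1) (by simp [c]) (by simpa [c] using (h2 i).symm)]
  · rw [affSwap_of_ne_of_ne a b, affSwap_of_ne_of_ne b c, affSwap_of_ne_of_ne a b,
      affSwap_of_ne_of_ne b c]

/-- Modulo `n` the affine permutation of a word permutes the positions as `toPerm` does. -/
theorem affPerm_wires (w : List (ZMod n)) (x : ℤ) :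
    (affPerm w x : ZMod n) = toPerm n ((coxeter n).wordProd w) x := by
  induction w with
  | nil => simp
  | cons i w ih =>
    rw [CoxeterSystem.wordProd_cons, map_mul, Equiv.Perm.mul_apply, ← ih]
    have : toPerm n ((coxeter n).simple i) = Equiv.swap i (i + 1) :=
      (coxeter n).lift_apply_simple (isLiftable_swap n) i
    rw [this, affPerm_cons]
    by_cases h : (affPerm w x : ZMod n) = i
    · rw [affSwap_of_eq h, h]; simp [h]
    · by_cases h' : (affPerm w x : ZMod n) = i + 1
      · rw [affSwap_of_eq_succ h', h']; simp [h']
      · rw [affSwap_of_ne_of_ne h h', Equiv.swap_apply_of_ne_of_ne h h']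

/-! ### Concatenation of reduced words -/

theorem NoDoubleCross.of_crossRed {a b : List (ZMod n)} (h : CrossRed (a ++ b)) :
    NoDoubleCross (affPerm a) (affPerm b) := by
  induction b using List.reverseRecOn with
  | nil => intro x y h1 h2; simp at h2; omega
  | append_singleton b i ih =>
    rw [← List.append_assoc, crossRed_snoc] at h
    intro x y hxy hlt
    simp only [affPerm_append, affPerm_cons, affPerm_nil] at hlt ⊢
    by_cases hc : y = x + 1 ∧ (x : ZMod n) = i
    · obtain ⟨rfl, hx⟩ := hc
      rw [affSwap_of_eq hx, affSwap_succ_of_eq hx]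
      simpa using h.2 x hx
    · exact ih h.1 _ _ (affSwap_lt_affSwap hxy hc) hlt

theorem CrossRed.of_append_right {a b : List (ZMod n)} (h : CrossRed (a ++ b)) : CrossRed b := by
  induction b using List.reverseRecOn with
  | nil => exact crossRed_nil
  | append_singleton b i ih =>
    rw [← List.append_assoc, crossRed_snoc] at h
    refine crossRed_snoc.2 ⟨ih h.1, fun x hx => ?_⟩
    by_contra hlt
    have hne : affPerm b x ≠ affPerm b (x + 1) := fun e => by
      have := affPerm_injective b e; omega
    have h1 := NoDoubleCross.of_crossRed h.1 x (x + 1) (by omega) (by omega)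
    have h2 := h.2 x hx
    simp only [affPerm_append] at h2
    omega

theorem crossRed_append {a b : List (ZMod n)} (ha : CrossRed a) (hb : CrossRed b)
    (h : NoDoubleCross (affPerm a) (affPerm b)) : CrossRed (a ++ b) := by
  induction b using List.reverseRecOn with
  | nil => simpa using ha
  | append_singleton b i ih =>
    rw [crossRed_snoc] at hb
    rw [← List.append_assoc, crossRed_snoc]
    constructor
    · refine ih hb.1 fun x y hxy hlt => ?_
      have hc : ¬ (y = x + 1 ∧ (x : ZMod n) = i) := by
        rintro ⟨rfl, hx⟩
        have := hb.2 x hx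
        omega
      simpa [hlt] using h _ _ (affSwap_lt_affSwap hxy hc)
    · intro x hx
      have := h x (x + 1) (by omega)
      simp only [affPerm_append, affPerm_cons, affPerm_nil, affSwap_of_eq hx,
        affSwap_succ_of_eq hx] at this ⊢
      exact this (hb.2 x hx)

theorem crossRed_append_iff {a b : List (ZMod n)} :
    CrossRed (a ++ b) ↔ CrossRed a ∧ CrossRed b ∧ NoDoubleCross (affPerm a) (affPerm b) :=
  ⟨fun h => ⟨h.of_append, h.of_append_right, .of_crossRed h⟩,
    fun h => crossRed_append h.1 h.2.1 h.2.2⟩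

/-! ### Exchange and Matsumoto's theorem -/

/-- The exchange property: a word with a descent at `j` becomes a word for its product with `s_j`
when one of its letters is deleted. -/
theorem exists_exchange (w : List (ZMod n)) {j : ZMod n} {x : ℤ} (hx : (x : ZMod n) = j)
    (h : affPerm w (x + 1) < affPerm w x) :
    ∃ w' : List (ZMod n), w'.length + 1 = w.length ∧
      ∀ y, affPerm w' y = affPerm w (affSwap j y) := by
  induction w with
  | nil => simp at h
  | cons k w ih =>
    by_cases hw : affPerm w (x + 1) < affPerm w x
    · obtain ⟨w', h1, h2⟩ := ih hw
      exact ⟨k :: w', by simp [h1], fun y => by simp [h2]⟩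
    · have hne : affPerm w x ≠ affPerm w (x + 1) := fun e => by
        have := affPerm_injective w e; omega
      obtain ⟨h1, h2⟩ := eq_succ_of_affSwap_lt (i := k) (x := affPerm w x)
        (y := affPerm w (x + 1)) (by omega) (by simpa using h)
      refine ⟨w, by simp, fun y => ?_⟩
      -- `affPerm w` carries the pairs exchanged by `s_j` to the pairs exchanged by `s_k`
      have key : ∀ z : ℤ, (z : ZMod n) = j →
          affPerm w (z + 1) = affPerm w z + 1 ∧ (affPerm w z : ZMod n) = k := by
        intro z hz
        have e : ((z - x : ℤ) : ZMod n) = 0 := by simp [hx, hz]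
        have e1 := affPerm_add w x (z - x) e
        have e2 := affPerm_add w (x + 1) (z - x) e
        rw [show x + (z - x) = z by ring] at e1
        rw [show x + 1 + (z - x) = z + 1 by ring] at e2
        refine ⟨by omega, ?_⟩
        rw [e1, Int.cast_add, e, add_zero, h2]
      rw [affPerm_cons]
      by_cases a : (y : ZMod n) = j
      · obtain ⟨k1, k2⟩ := key y a
        rw [affSwap_of_eq a, k1, affSwap_succ_of_eq k2]
      · by_cases b : (y : ZMod n) = j + 1
        · obtain ⟨k1, k2⟩ := key (y - 1) (by simp [b])
          rw [affSwap_of_eq_succ b, affSwap_of_eq k2, ← k1, sub_add_cancel]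
        · rw [affSwap_of_ne_of_ne a b]
          have inv : ∀ z : ℤ, ((affPerm w z : ℤ) : ZMod n) = (affPerm w y : ℤ) →
              (z : ZMod n) = y := by
            intro z hz
            have e : ((affPerm w z - affPerm w y : ℤ) : ZMod n) = 0 := by simp [hz]
            have := affPerm_add w y _ e
            rw [show affPerm w y + (affPerm w z - affPerm w y) = affPerm w z by ring] at this
            rw [← affPerm_injective w this, Int.cast_add, e, add_zero]
          rw [affSwap_of_ne_of_ne]
          · intro hk
            exact a ((inv x (by rw [h2, hk])).symm.trans hx)
          · intro hk
            exact b ((inv (x + 1) (by rw [h1, Int.cast_add, h2, hk]; simp)).symm.trans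
              (by simp [hx]))

/-- Every word has the same affine permutation as a crossing-reduced word that is not longer. -/
theorem exists_crossRed (w : List (ZMod n)) :
    ∃ w' : List (ZMod n), CrossRed w' ∧ w'.length ≤ w.length ∧ affPerm w' = affPerm w := by
  induction hL : w.length using Nat.strong_induction_on generalizing w with
  | _ L ih =>
    rcases List.eq_nil_or_concat w with rfl | ⟨w1, i, rfl⟩
    · exact ⟨[], crossRed_nil, by simp, rfl⟩
    · rw [List.concat_eq_append] at *
      simp only [List.length_append, List.length_cons, List.length_nil] at hL
      obtain ⟨w2, r2, l2, e2⟩ := ih w1.length (by omega) w1 rfl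
      obtain ⟨x, hx⟩ := ZMod.intCast_surjective i
      by_cases hlt : affPerm w2 x < affPerm w2 (x + 1)
      · refine ⟨w2 ++ [i], crossRed_snoc.2 ⟨r2, fun y hy =>
          affPerm_lt_succ_of_eq w2 (hx.trans hy.symm) hlt⟩, by simp; omega, ?_⟩
        funext y; simp [e2]
      · have hne : affPerm w2 x ≠ affPerm w2 (x + 1) := fun e => by
          have := affPerm_injective w2 e; omega
        obtain ⟨w3, l3, e3⟩ := exists_exchange w2 hx (by omega)
        obtain ⟨w4, r4, l4, e4⟩ := ih w3.length (by omega) w3 rfl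
        exact ⟨w4, r4, by omega, by funext y; rw [e4, e3, e2]; simp⟩

/-- A word with descents at two different letters `i` and `j` has two reduced words, ending with
`i` and with `j`, that differ by one move. -/
theorem exists_moveEquiv_of_descents (w : List (ZMod n)) {i j : ZMod n} (hij : i ≠ j) {x y : ℤ}
    (hx : (x : ZMod n) = i) (hy : (y : ZMod n) = j) (hdx : affPerm w (x + 1) < affPerm w x)
    (hdy : affPerm w (y + 1) < affPerm w y) :
    ∃ p q : List (ZMod n), CrossRed (p ++ [i]) ∧ CrossRed (q ++ [j]) ∧
      affPerm (p ++ [i]) = affPerm w ∧ affPerm (q ++ [j]) = affPerm w ∧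
      MoveEquiv n (p ++ [i]) (q ++ [j]) ∧ MoveEquiv n (q ++ [j]) (p ++ [i]) := by
  by_cases hadj : i = j + 1 ∨ j = i + 1
  · wlog hj : j = i + 1 generalizing i j x y
    · obtain ⟨p, q, h1, h2, h3, h4, h5, h6⟩ :=
        this hij.symm hy hx hdy hdx hadj.symm (hadj.resolve_right hj)
      exact ⟨q, p, h2, h1, h4, h3, h6, h5⟩
    subst hj
    have hdy' : affPerm w (x + 1 + 1) < affPerm w (x + 1) := by
      have e : ((x + 1 - y : ℤ) : ZMod n) = 0 := by simp [hx, hy]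
      have e1 := affPerm_add w y _ e
      have e2 := affPerm_add w (y + 1) _ e
      rw [show y + (x + 1 - y) = x + 1 by ring] at e1
      rw [show y + 1 + (x + 1 - y) = x + 1 + 1 by ring] at e2
      omega
    have hn2 : n ≠ 2 := by
      rintro rfl
      have := affPerm_add w x 2 rfl
      rw [show x + 2 = x + 1 + 1 by ring] at this
      omega
    have hx1 : ((x + 1 : ℤ) : ZMod n) = i + 1 := by simp [hx]
    -- the two letters act on `x, x + 1, x + 2` as the two adjacent transpositions
    have a1 : affSwap i x = x + 1 := affSwap_of_eq hx
    have a2 : affSwap i (x + 1) = x := affSwap_succ_of_eq hx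
    have a3 : affSwap i (x + 1 + 1) = x + 1 + 1 :=
      affSwap_of_ne_of_ne (by simpa [hx] using add_one_add_one_ne hn2 i) (by simp [hx])
    have b1 : affSwap (i + 1) x = x :=
      affSwap_of_ne_of_ne (by simp [hx]) (by rw [hx]; exact (add_one_add_one_ne hn2 i).symm)
    have b2 : affSwap (i + 1) (x + 1) = x + 1 + 1 := affSwap_of_eq hx1
    have b3 : affSwap (i + 1) (x + 1 + 1) = x + 1 := affSwap_succ_of_eq hx1
    obtain ⟨w3, r3, -, e3⟩ := exists_crossRed (w ++ [i, i + 1, i])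
    have f1 : affPerm w3 x = affPerm w (x + 1 + 1) := by simp [e3, a1, b2, a3]
    have f2 : affPerm w3 (x + 1) = affPerm w (x + 1) := by simp [e3, a2, b1, a1]
    have f3 : affPerm w3 (x + 1 + 1) = affPerm w x := by simp [e3, a3, b3, a2]
    have hm : affineMatrix n i (i + 1) = 3 := by simp [affineMatrix, hn2]
    have hm' : affineMatrix n (i + 1) i = 3 := by simp [affineMatrix, hn2]
    have p1 : CrossRed (w3 ++ [i]) := r3.snoc hx (by omega)
    have p2 : CrossRed (w3 ++ [i] ++ [i + 1]) := p1.snoc hx1 (by simp [a2, a3]; omega)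
    have p3 : CrossRed (w3 ++ [i] ++ [i + 1] ++ [i]) :=
      p2.snoc hx (by simp [a1, b1, b2, a3]; omega)
    have q1 : CrossRed (w3 ++ [i + 1]) := r3.snoc hx1 (by omega)
    have q2 : CrossRed (w3 ++ [i + 1] ++ [i]) := q1.snoc hx (by simp [b1, b2]; omega)
    have q3 : CrossRed (w3 ++ [i + 1] ++ [i] ++ [i + 1]) :=
      q2.snoc hx1 (by simp [a2, b1, a3, b3]; omega)
    have m1 : WordMove n (w3 ++ [i] ++ [i + 1] ++ [i]) (w3 ++ [i + 1] ++ [i] ++ [i + 1]) := by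
      simpa using WordMove.braid w3 [] i (i + 1) hm
    have m2 : WordMove n (w3 ++ [i + 1] ++ [i] ++ [i + 1]) (w3 ++ [i] ++ [i + 1] ++ [i]) := by
      simpa using WordMove.braid w3 [] (i + 1) i hm'
    have hf : affPerm (w3 ++ [i] ++ [i + 1] ++ [i]) = affPerm w := by
      funext z; simp [e3]
    refine ⟨_, _, p3, q3, hf, ?_, .single m1, .single m2⟩
    rw [← hf]
    funext z
    simp only [affPerm_append, affPerm_cons, affPerm_nil]
    rw [affSwap_braid hm]
  · push Not at hadj
    have hm : affineMatrix n i j = 2 := by simp [affineMatrix, hij, hadj]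
    have hm' : affineMatrix n j i = 2 := by simp [affineMatrix, hij.symm, hadj]
    have a1 : affSwap i y = y :=
      affSwap_of_ne_of_ne (by rw [hy]; exact hij.symm) (by rw [hy]; exact hadj.2)
    have a2 : affSwap i (y + 1) = y + 1 :=
      affSwap_of_ne_of_ne (by simpa [hy] using hadj.1.symm) (by simpa [hy] using hij.symm)
    have b1 : affSwap j x = x :=
      affSwap_of_ne_of_ne (by rw [hx]; exact hij) (by rw [hx]; exact hadj.1)
    have b2 : affSwap j (x + 1) = x + 1 :=
      affSwap_of_ne_of_ne (by simpa [hx] using hadj.2.symm) (by simpa [hx] using hij)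
    obtain ⟨w3, r3, -, e3⟩ := exists_crossRed (w ++ [i, j])
    have f1 : affPerm w3 x = affPerm w (x + 1) := by simp [e3, b1, affSwap_of_eq hx]
    have f2 : affPerm w3 (x + 1) = affPerm w x := by simp [e3, b2, affSwap_succ_of_eq hx]
    have f3 : affPerm w3 y = affPerm w (y + 1) := by simp [e3, affSwap_of_eq hy, a2]
    have f4 : affPerm w3 (y + 1) = affPerm w y := by simp [e3, affSwap_succ_of_eq hy, a1]
    have p1 : CrossRed (w3 ++ [i]) := r3.snoc hx (by omega)
    have p2 : CrossRed (w3 ++ [i] ++ [j]) := p1.snoc hy (by simp [a1, a2]; omega)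
    have q1 : CrossRed (w3 ++ [j]) := r3.snoc hy (by omega)
    have q2 : CrossRed (w3 ++ [j] ++ [i]) := q1.snoc hx (by simp [b1, b2]; omega)
    have m1 : WordMove n (w3 ++ [i] ++ [j]) (w3 ++ [j] ++ [i]) := by
      simpa using WordMove.comm w3 [] i j hm
    have m2 : WordMove n (w3 ++ [j] ++ [i]) (w3 ++ [i] ++ [j]) := by
      simpa using WordMove.comm w3 [] j i hm'
    have hf : affPerm (w3 ++ [j] ++ [i]) = affPerm w := by
      funext z; simp [e3]
    refine ⟨_, _, q2, p2, hf, ?_, .single m2, .single m1⟩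
    rw [← hf]
    funext z
    simp [affSwap_comm hm]

/-- Matsumoto's theorem: two reduced words with the same affine permutation are related by braid
and commutation moves. -/
theorem CrossRed.moveEquiv {w w' : List (ZMod n)} (h : CrossRed w) (h' : CrossRed w')
    (e : affPerm w = affPerm w') : MoveEquiv n w w' := by
  induction hL : w.length generalizing w w' with
  | zero =>
    obtain rfl := List.eq_nil_of_length_eq_zero hL
    rcases List.eq_nil_or_concat w' with rfl | ⟨w2, j, rfl⟩
    · exact .refl
    · exfalso
      rw [List.concat_eq_append] at *
      obtain ⟨y, hy⟩ := ZMod.intCast_surjective j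
      have h1 := (crossRed_snoc.1 h').2 y hy
      have e1 := congrFun e y
      have e2 := congrFun e (y + 1)
      simp only [affPerm_append, affPerm_cons, affPerm_nil, affSwap_of_eq hy,
        affSwap_succ_of_eq hy] at e1 e2
      omega
  | succ L ih =>
    have hd : ∀ {w1 : List (ZMod n)} {i : ZMod n} {x : ℤ}, (x : ZMod n) = i →
        CrossRed (w1 ++ [i]) → affPerm (w1 ++ [i]) (x + 1) < affPerm (w1 ++ [i]) x := by
      intro w1 i x hx hr
      simpa [affSwap_of_eq hx, affSwap_succ_of_eq hx] using (crossRed_snoc.1 hr).2 x hx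
    rcases List.eq_nil_or_concat w with rfl | ⟨w1, i, rfl⟩
    · simp at hL
    rw [List.concat_eq_append] at *
    simp only [List.length_append, List.length_cons, List.length_nil, zero_add,
      Nat.add_right_cancel_iff] at hL
    obtain ⟨x, hx⟩ := ZMod.intCast_surjective i
    have hdx := hd hx h
    rcases List.eq_nil_or_concat w' with rfl | ⟨w2, j, rfl⟩
    · rw [e] at hdx
      simp at hdx
    rw [List.concat_eq_append] at *
    by_cases hij : i = j
    · subst hij
      exact (ih h.of_append h'.of_append (affPerm_append_right_cancel e) hL).append_right [i]
    · obtain ⟨y, hy⟩ := ZMod.intCast_surjective j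
      have hdy := hd hy h'
      rw [← e] at hdy
      obtain ⟨p, q, h1, h2, h3, h4, h5, -⟩ := exists_moveEquiv_of_descents _ hij hx hy hdx hdy
      have k1 := ih h.of_append h1.of_append (affPerm_append_right_cancel h3.symm) hL
      have hlen := h5.length_eq
      have hlen' := k1.length_eq
      simp only [List.length_append, List.length_cons, List.length_nil, zero_add,
        Nat.add_right_cancel_iff] at hlen
      have k2 := ih h2.of_append h'.of_append (affPerm_append_right_cancel (h4.trans e)) (by omega)
      exact (k1.append_right [i]).trans (h5.trans (k2.append_right [j]))

/-- Reduced words of the affine symmetric group are reduced with respect to affine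
permutations. If a letter of the word met a descent, Matsumoto's theorem would move the same
letter in front of it, and the two would cancel. -/
theorem crossRed_of_isReduced {w : List (ZMod n)} (h : (coxeter n).IsReduced w) :
    CrossRed w := by
  induction w using List.reverseRecOn with
  | nil => exact crossRed_nil
  | append_singleton w i ih =>
    have hw : CrossRed w := ih (by simpa using h.take w.length)
    obtain ⟨x, hx⟩ := ZMod.intCast_surjective i
    refine hw.snoc hx ?_
    by_contra hlt
    have hne : affPerm w x ≠ affPerm w (x + 1) := fun e => by
      have := affPerm_injective w e; omega
    obtain ⟨w2, l2, e2⟩ := exists_exchange w hx (by omega)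
    obtain ⟨w3, r3, l3, e3⟩ := exists_crossRed w2
    have hlt3 : affPerm w3 x < affPerm w3 (x + 1) := by
      rw [e3, e2, e2, affSwap_of_eq hx, affSwap_succ_of_eq hx]; omega
    have hm : MoveEquiv n w (w3 ++ [i]) :=
      hw.moveEquiv (r3.snoc hx hlt3) (by funext z; simp [e3, e2])
    have hp : (coxeter n).wordProd (w ++ [i]) = (coxeter n).wordProd w3 := by
      rw [CoxeterSystem.wordProd_append, hm.wordProd_eq, CoxeterSystem.wordProd_append, mul_assoc,
        ← CoxeterSystem.wordProd_append]
      simp only [List.cons_append, List.nil_append, CoxeterSystem.wordProd_cons,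
        CoxeterSystem.wordProd_nil, mul_one, CoxeterSystem.simple_mul_simple_self]
    have hlen := (coxeter n).length_wordProd_le w3
    rw [← hp, h] at hlen
    simp only [List.length_append, List.length_cons, List.length_nil] at hlen
    omega

end

/-! ### The column action of weighted words -/

/-- The action of one weighted letter `s_i(c)` on sequences of vectors: `c` times the preceding
vector is added to each vector whose index is `≡ i + 1`. On the columns of a matrix this is right
multiplication by the periodic unipotent matrix `x_i(c)`. -/
def columnStep (f : ℤ → ℤ → ℝ) (p : ZMod n × PosReal) : ℤ → ℤ → ℝ := fun j =>
  if (j : ZMod n) = p.1 + 1 then f j + (p.2 : ℝ) • f (j - 1) else f j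

/-- The action of a weighted word on sequences of vectors; the first letter acts first. -/
def columns (X : List (ZMod n × PosReal)) (f : ℤ → ℤ → ℝ) : ℤ → ℤ → ℝ := X.foldl columnStep f

@[simp] theorem columns_nil (f : ℤ → ℤ → ℝ) :
    columns ([] : List (ZMod n × PosReal)) f = f := rfl

@[simp] theorem columns_cons (p : ZMod n × PosReal) (X : List (ZMod n × PosReal))
    (f : ℤ → ℤ → ℝ) : columns (p :: X) f = columns X (columnStep f p) := rfl

@[simp] theorem columns_append (X Y : List (ZMod n × PosReal)) (f : ℤ → ℤ → ℝ) :
    columns (X ++ Y) f = columns Y (columns X f) := by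
  simp [columns]

/-- The span of the vectors with index greater than `j`. -/
def spanGT (f : ℤ → ℤ → ℝ) (j : ℤ) : Submodule ℝ (ℤ → ℝ) :=
  Submodule.span ℝ (f '' Set.Ioi j)

/-- The vectors whose coordinates below `m` vanish. -/
def vanishBelow (m : ℤ) : Submodule ℝ (ℤ → ℝ) where
  carrier := {v | ∀ r < m, v r = 0}
  add_mem' := fun ha hb r hr => by simp [ha r hr, hb r hr]
  zero_mem' := fun _ _ => rfl
  smul_mem' := fun c v hv r hr => by simp [hv r hr]

theorem vanishBelow_anti {m m' : ℤ} (h : m ≤ m') : vanishBelow m' ≤ vanishBelow m :=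
  fun _ hv r hr => hv r (by omega)

/-- A sequence of vectors is adapted to `g` if, modulo the later vectors, the `j`-th vector has its
first nonzero coordinate in place `g j`. For the columns of a matrix this describes the Bruhat
cell of `g`. -/
def Adapted (f : ℤ → ℤ → ℝ) (g : ℤ → ℤ) : Prop :=
  ∀ j, f j ∈ spanGT f j ⊔ vanishBelow (g j) ∧ f j ∉ spanGT f j ⊔ vanishBelow (g j + 1)

theorem spanGT_eq_sup (f : ℤ → ℤ → ℝ) (j : ℤ) :
    spanGT f j = Submodule.span ℝ {f (j + 1)} ⊔ spanGT f (j + 1) := by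
  have : Set.Ioi j = insert (j + 1) (Set.Ioi (j + 1)) := by
    ext k; simp only [Set.mem_Ioi, Set.mem_insert_iff]; omega
  rw [spanGT, this, Set.image_insert_eq, Submodule.span_insert, spanGT]

theorem adapted_single : Adapted (fun j => Pi.single j 1) id := by
  intro j
  refine ⟨Submodule.mem_sup_right fun r hr => ?_, fun h => ?_⟩
  · exact Pi.single_eq_of_ne (by simp at hr; omega) _
  · have hle : spanGT (fun j => Pi.single j 1) j ⊔ vanishBelow (id j + 1) ≤
        vanishBelow (j + 1) := by
      refine sup_le (Submodule.span_le.2 ?_) le_rfl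
      rintro _ ⟨k, hk, rfl⟩ r hr
      simp only [Set.mem_Ioi] at hk
      exact Pi.single_eq_of_ne (by omega) _
    have := hle h j (by omega)
    simp at this

theorem columnStep_succ (f : ℤ → ℤ → ℝ) {i : ZMod n} (c : PosReal) {x : ℤ}
    (hx : (x : ZMod n) = i) : columnStep f (i, c) (x + 1) = f (x + 1) + (c : ℝ) • f x := by
  simp [columnStep, hx]

theorem columnStep_comm {i j : ZMod n} (h : affineMatrix n i j = 2) (a b : PosReal)
    (f : ℤ → ℤ → ℝ) :
    columnStep (columnStep f (i, a)) (j, b) = columnStep (columnStep f (j, b)) (i, a) := by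
  obtain ⟨h1, h2, h3⟩ : i ≠ j ∧ i ≠ j + 1 ∧ j ≠ i + 1 := by
    simp only [affineMatrix, Matrix.of_apply] at h
    split_ifs at h <;> simp_all
  funext m
  by_cases e : (m : ZMod n) = i + 1
  · simp [columnStep, e, h1, h2]
  · by_cases e' : (m : ZMod n) = j + 1
    · simp [columnStep, e', h1.symm, h3]
    · simp [columnStep, e, e']

section
variable [Fact (1 < n)]

theorem columnStep_of_eq (f : ℤ → ℤ → ℝ) {i : ZMod n} (c : PosReal) {x : ℤ}
    (hx : (x : ZMod n) = i) : columnStep f (i, c) x = f x := by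
  simp [columnStep, hx]

theorem spanGT_columnStep (f : ℤ → ℤ → ℝ) {i : ZMod n} (c : PosReal) {j : ℤ}
    (hj : (j : ZMod n) ≠ i) : spanGT (columnStep f (i, c)) j = spanGT f j := by
  have aux : ∀ k : ℤ, j < k → (k : ZMod n) = i + 1 → j < k - 1 ∧ ((k - 1 : ℤ) : ZMod n) = i := by
    intro k hk e
    have e' : ((k - 1 : ℤ) : ZMod n) = i := by simp [e]
    refine ⟨?_, e'⟩
    by_contra hlt
    exact hj (by rw [← e']; congr 1; omega)
  apply le_antisymm <;> refine Submodule.span_le.2 ?_ <;> rintro _ ⟨k, hk, rfl⟩ <;>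
    simp only [Set.mem_Ioi] at hk
  · unfold columnStep
    split_ifs with h
    · exact add_mem (Submodule.subset_span ⟨k, hk, rfl⟩)
        (Submodule.smul_mem _ _ (Submodule.subset_span ⟨k - 1, (aux k hk h).1, rfl⟩))
    · exact Submodule.subset_span ⟨k, hk, rfl⟩
  · by_cases h : (k : ZMod n) = i + 1
    · obtain ⟨h1, h2⟩ := aux k hk h
      have h3 := columnStep_succ f c h2
      rw [sub_add_cancel] at h3
      have h4 : f k = columnStep f (i, c) k - (c : ℝ) • columnStep f (i, c) (k - 1) := by
        rw [h3, columnStep_of_eq f c h2, add_sub_cancel_right]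
      rw [h4]
      exact sub_mem (Submodule.subset_span ⟨k, hk, rfl⟩)
        (Submodule.smul_mem _ _ (Submodule.subset_span ⟨k - 1, h1, rfl⟩))
    · exact Submodule.subset_span ⟨k, hk, by simp [columnStep, h]⟩

/-- Replacing `v` by `v + c u` exchanges the roles of `u` and `v` in a pivoting argument. -/
theorem notMem_span_add_sup {E : Type*} [AddCommGroup E] [Module ℝ E] {B D : Submodule ℝ E}
    (hDB : D ≤ B) {u v : E} {c : ℝ} (hu : u ∉ Submodule.span ℝ {v} ⊔ B) (hv : v ∉ D) :
    u ∉ Submodule.span ℝ {v + c • u} ⊔ D := by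
  intro hmem
  obtain ⟨y, hy, m, hm, e⟩ := Submodule.mem_sup.1 hmem
  obtain ⟨t, rfl⟩ := Submodule.mem_span_singleton.1 hy
  have e' : (1 - t * c) • u = t • v + m := by
    rw [sub_smul, one_smul, sub_eq_iff_eq_add]
    conv_lhs => rw [← e]
    rw [smul_add, smul_smul]; abel
  by_cases ht : 1 - t * c = 0
  · rw [ht, zero_smul] at e'
    have ht0 : t ≠ 0 := by rintro rfl; simp at ht
    apply hv
    have : v = t⁻¹ • -m := by
      rw [← eq_neg_of_add_eq_zero_left e'.symm, smul_smul, inv_mul_cancel₀ ht0, one_smul]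
    rw [this]
    exact Submodule.smul_mem _ _ (neg_mem hm)
  · apply hu
    have : u = (1 - t * c)⁻¹ • (t • v + m) := by
      rw [← e', smul_smul, inv_mul_cancel₀ ht, one_smul]
    rw [this]
    exact Submodule.smul_mem _ _ (Submodule.add_mem_sup
      (Submodule.smul_mem _ _ (Submodule.mem_span_singleton_self _)) (hDB hm))

theorem Adapted.columnStep {f : ℤ → ℤ → ℝ} {g : ℤ → ℤ} (hf : Adapted f g) {i : ZMod n}
    (c : PosReal) (hg : ∀ x : ℤ, (x : ZMod n) = i → g x < g (x + 1)) :
    Adapted (columnStep f (i, c)) fun x => g (affSwap i x) := by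
  have hc : (c : ℝ) ≠ 0 := c.2.ne'
  intro j
  by_cases h1 : (j : ZMod n) = i
  · obtain ⟨hu, hu'⟩ := hf j
    obtain ⟨hv, hv'⟩ := hf (j + 1)
    have hlt := hg j h1
    have hj1 : ((j + 1 : ℤ) : ZMod n) ≠ i := by simp [h1]
    simp only [affSwap_of_eq h1]
    rw [spanGT_eq_sup, spanGT_columnStep f c hj1, columnStep_of_eq f c h1, columnStep_succ f c h1]
    rw [spanGT_eq_sup] at hu hu'
    generalize spanGT f (j + 1) = A at *
    rw [sup_assoc] at hu hu'
    rw [sup_assoc, sup_assoc]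
    constructor
    · have e : f j = (c : ℝ)⁻¹ • (f (j + 1) + (c : ℝ) • f j) + (-(c : ℝ)⁻¹) • f (j + 1) := by
        rw [smul_add, smul_smul, inv_mul_cancel₀ hc, one_smul, neg_smul]; abel
      have h1 : (c : ℝ)⁻¹ • (f (j + 1) + (c : ℝ) • f j) ∈
          Submodule.span ℝ {f (j + 1) + (c : ℝ) • f j} :=
        Submodule.smul_mem _ _ (Submodule.mem_span_singleton_self _)
      have h2 : (-(c : ℝ)⁻¹) • f (j + 1) ∈ A ⊔ vanishBelow (g (j + 1)) :=
        Submodule.smul_mem _ _ hv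
      have h3 := Submodule.add_mem_sup h1 h2
      rwa [← e] at h3
    · exact notMem_span_add_sup (sup_le_sup_left (vanishBelow_anti (by omega)) A) hu' hv'
  by_cases h2 : (j : ZMod n) = i + 1
  · obtain ⟨x, rfl⟩ : ∃ x, j = x + 1 := ⟨j - 1, by ring⟩
    have hx : (x : ZMod n) = i := by simpa using h2
    obtain ⟨hu, hu'⟩ := hf x
    obtain ⟨hv, hv'⟩ := hf (x + 1)
    have hlt := hg x hx
    simp only [affSwap_succ_of_eq hx]
    rw [spanGT_columnStep f c h1, columnStep_succ f c hx]
    rw [spanGT_eq_sup] at hu hu'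
    generalize spanGT f (x + 1) = A at *
    rw [sup_assoc] at hu hu'
    have hv2 : f (x + 1) ∈ A ⊔ vanishBelow (g x + 1) :=
      sup_le_sup_left (vanishBelow_anti (by omega)) A hv
    have hle : A ⊔ vanishBelow (g x + 1) ≤ A ⊔ vanishBelow (g x) :=
      sup_le_sup_left (vanishBelow_anti (by omega)) A
    constructor
    · refine add_mem (hle hv2) (Submodule.smul_mem _ _ ?_)
      have hsup : Submodule.span ℝ {f (x + 1)} ⊔ (A ⊔ vanishBelow (g x)) ≤
          A ⊔ vanishBelow (g x) :=
        sup_le ((Submodule.span_singleton_le_iff_mem _ _).2 (hle hv2)) le_rfl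
      exact hsup hu
    · intro hmem
      have h3 : (c : ℝ) • f x ∈ A ⊔ vanishBelow (g x + 1) := by
        simpa using sub_mem hmem hv2
      exact hu' (Submodule.mem_sup_right ((Submodule.smul_mem_iff _ hc).1 h3))
  · simp only [affSwap_of_ne_of_ne h1 h2, spanGT_columnStep f c h1]
    simpa [AffineDKdV.columnStep, h2] using hf j

/-- The last weighted letter of a reduced word is determined by the columns: modulo the later
columns, only one multiple of column `x` can be subtracted from column `x + 1` to make its entry in
row `g x` vanish. -/
theorem Adapted.columnStep_inj {f f' : ℤ → ℤ → ℝ} {g : ℤ → ℤ} (hf : Adapted f g)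
    (hf' : Adapted f' g) {i : ZMod n} {c c' : PosReal}
    (hg : ∀ x : ℤ, (x : ZMod n) = i → g x < g (x + 1))
    (h : AffineDKdV.columnStep f (i, c) = AffineDKdV.columnStep f' (i, c')) :
    c = c' ∧ f = f' := by
  have hoff : ∀ x : ℤ, (x : ZMod n) ≠ i + 1 → f x = f' x := by
    intro x hx
    simpa [AffineDKdV.columnStep, hx] using congrFun h x
  have hcc : c = c' := by
    obtain ⟨x, hx⟩ := ZMod.intCast_surjective i
    have hlt := hg x hx
    have hx1 : ((x + 1 : ℤ) : ZMod n) ≠ i := by simp [hx]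
    have hfx : f x = f' x := hoff x (by simp [hx])
    have hS : spanGT f (x + 1) = spanGT f' (x + 1) := by
      rw [← spanGT_columnStep f c hx1, h, spanGT_columnStep f' c' hx1]
    have hv := (hf (x + 1)).1
    have hv' := (hf' (x + 1)).1
    have hu' := (hf x).2
    rw [spanGT_eq_sup, sup_assoc] at hu'
    rw [← hS] at hv'
    have e := congrFun h (x + 1)
    rw [columnStep_succ f c hx, columnStep_succ f' c' hx, ← hfx] at e
    have hle : spanGT f (x + 1) ⊔ vanishBelow (g (x + 1)) ≤
        spanGT f (x + 1) ⊔ vanishBelow (g x + 1) :=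
      sup_le_sup_left (vanishBelow_anti (by omega)) _
    by_contra hne
    have hne' : (c : ℝ) - c' ≠ 0 := fun h0 => hne (Subtype.ext (sub_eq_zero.1 h0))
    have e' : ((c : ℝ) - c') • f x = f' (x + 1) - f (x + 1) := by
      rw [sub_smul, sub_eq_sub_iff_add_eq_add, add_comm, e]
    refine hu' (Submodule.mem_sup_right ((Submodule.smul_mem_iff _ hne').1 ?_))
    rw [e']
    exact hle (sub_mem hv' hv)
  refine ⟨hcc, funext fun x => ?_⟩
  by_cases hx : (x : ZMod n) = i + 1
  · have e := congrFun h x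
    have := hoff (x - 1) (by simp [hx])
    simpa [AffineDKdV.columnStep, hx, hcc, this] using e
  · exact hoff x hx

/-- The standard unit vectors. -/
abbrev unitColumns : ℤ → ℤ → ℝ := fun j => Pi.single j 1

/-- The columns of a reduced weighted word lie in the Bruhat cell of its affine permutation. -/
theorem adapted_columns {X : List (ZMod n × PosReal)} (h : CrossRed (X.map Prod.fst)) :
    Adapted (columns X unitColumns) (affPerm (X.map Prod.fst)) := by
  induction X using List.reverseRecOn with
  | nil => exact adapted_single
  | append_singleton X p ih =>
    rw [List.map_append, List.map_cons, List.map_nil, crossRed_snoc] at h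
    have := (ih h.1).columnStep p.2 h.2
    simp only [List.map_append, List.map_cons, List.map_nil, columns_append, columns_cons,
      columns_nil]
    convert this using 1
    funext x
    simp

/-- Two weighted words that end in weightings of the same word, begin with words of the same affine
permutation, are reduced and have the same columns, have the same weights at the end. -/
theorem weights_eq_of_columns_eq {X X' Z Z' : List (ZMod n × PosReal)}
    (hr : CrossRed ((X ++ Z).map Prod.fst)) (hr' : CrossRed ((X' ++ Z').map Prod.fst))
    (hX : affPerm (X.map Prod.fst) = affPerm (X'.map Prod.fst))
    (hZ : Z.map Prod.fst = Z'.map Prod.fst)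
    (h : columns (X ++ Z) unitColumns = columns (X' ++ Z') unitColumns) :
    Z = Z' ∧ columns X unitColumns = columns X' unitColumns := by
  induction Z using List.reverseRecOn generalizing Z' with
  | nil =>
    obtain rfl : Z' = [] := by simpa using hZ.symm
    exact ⟨rfl, by simpa using h⟩
  | append_singleton Z p ih =>
    rcases List.eq_nil_or_concat Z' with rfl | ⟨Z', p', rfl⟩
    · simp at hZ
    rw [List.concat_eq_append] at *
    rw [List.map_append, List.map_append] at hZ
    have hp := (List.append_inj' hZ rfl).2
    replace hZ := (List.append_inj' hZ rfl).1
    have hp' : p.1 = p'.1 := by simpa using hp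
    rw [← List.append_assoc, List.map_append] at hr hr'
    have hr1 := crossRed_snoc.1 hr
    have hr1' := crossRed_snoc.1 hr'
    have hperm : affPerm ((X' ++ Z').map Prod.fst) = affPerm ((X ++ Z).map Prod.fst) := by
      funext x; simp [hX, hZ]
    obtain ⟨i, c⟩ := p
    obtain ⟨i', c'⟩ := p'
    obtain rfl : i = i' := hp'
    have had' := adapted_columns hr1'.1
    rw [hperm] at had'
    obtain ⟨rfl, e⟩ := (adapted_columns hr1.1).columnStep_inj (c := c) (c' := c') had' hr1.2
      (by simpa using h)
    obtain ⟨rfl, e2⟩ := ih hr1.1 hr1'.1 hZ e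
    exact ⟨rfl, e2⟩

theorem columnStep_braid {i j : ZMod n} (h : affineMatrix n i j = 3) (a b c : PosReal)
    (f : ℤ → ℤ → ℝ) :
    columnStep (columnStep (columnStep f (i, a)) (j, b)) (i, c) =
      columnStep (columnStep (columnStep f (j, b * c / (a + c))) (i, a + c))
        (j, a * b / (a + c)) := by
  obtain ⟨hij, hadj, hn⟩ : i ≠ j ∧ (i = j + 1 ∨ j = i + 1) ∧ n ≠ 2 := by
    simp only [affineMatrix, Matrix.of_apply] at h
    split_ifs at h <;> simp_all
  have h2 := add_one_add_one_ne hn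
  have hac : (a : ℝ) + c ≠ 0 := (add_pos a.2 c.2).ne'
  have e1 : ((b * c / (a + c) : PosReal) : ℝ) = b * c / (a + c) := rfl
  have e2 : ((a * b / (a + c) : PosReal) : ℝ) = a * b / (a + c) := rfl
  have e3 : ((a + c : PosReal) : ℝ) = a + c := rfl
  funext m
  rcases hadj with rfl | rfl
  · by_cases e : (m : ZMod n) = j + 1
    · ext r
      simp [columnStep, e, (h2 j).symm, e1, e2]
      field_simp
      ring
    · by_cases e' : (m : ZMod n) = j + 1 + 1
      · ext r
        simp [columnStep, e', (h2 j).symm, e1, e3]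
        field_simp
        ring
      · simp [columnStep, e, e']
  · by_cases e : (m : ZMod n) = i + 1
    · ext r
      simp [columnStep, e, (h2 i).symm, e3]
      field_simp
      ring
    · by_cases e' : (m : ZMod n) = i + 1 + 1
      · ext r
        simp [columnStep, e', (h2 i).symm, e1, e2, e3]
        field_simp
        ring
      · simp [columnStep, e, e']

theorem columns_eq_of_move {X Y : List (ZMod n × PosReal)} (h : LusztigMove n X Y) :
    columns X = columns Y := by
  funext f
  cases h with
  | braid A B i j a b c h => simp [columnStep_braid h]
  | comm A B i j a b h => simp [columnStep_comm h]

/-- Weighted words related by Lusztig moves. -/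
abbrev Moves (n : ℕ) : List (ZMod n × PosReal) → List (ZMod n × PosReal) → Prop :=
  Relation.ReflTransGen (LusztigMove n)

theorem columns_eq_of_moves {X Y : List (ZMod n × PosReal)}
    (h : Moves n X Y) : columns X = columns Y := by
  induction h with
  | refl => rfl
  | tail _ h ih => rw [ih, columns_eq_of_move h]

end

/-! ### Transport of weights -/

/-- The value at `p` of a family of weighted words whose weights are continuous functions. -/
def evalAt {P : Type*} [TopologicalSpace P] (p : P) (L : List (ZMod n × C(P, PosReal))) :
    List (ZMod n × PosReal) :=
  L.map fun q => (q.1, q.2 p)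

theorem continuous_mul_div {P : Type*} [TopologicalSpace P] (a b c : C(P, PosReal)) :
    Continuous fun p => a p * b p / c p := by
  refine Continuous.subtype_mk (f := fun p => (a p : ℝ) * b p / c p) ?_ _
  refine Continuous.div (by fun_prop) (by fun_prop) fun p => (c p).2.ne'

theorem continuous_add_posReal {P : Type*} [TopologicalSpace P] (a c : C(P, PosReal)) :
    Continuous fun p => a p + c p :=
  Continuous.subtype_mk (f := fun p => (a p : ℝ) + c p) (by fun_prop) _

theorem WordMove.exists_family {P : Type*} [TopologicalSpace P] {w w' : List (ZMod n)}
    (h : WordMove n w w') (L : List (ZMod n × C(P, PosReal))) (hL : L.map Prod.fst = w) :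
    ∃ L' : List (ZMod n × C(P, PosReal)), L'.map Prod.fst = w' ∧
      ∀ p, LusztigMove n (evalAt p L) (evalAt p L') := by
  cases h with
  | braid A B i j h =>
    obtain ⟨L1, LB, rfl, h1, rfl⟩ := List.map_eq_append_iff.1 hL
    obtain ⟨LA, L2, rfl, rfl, h2⟩ := List.map_eq_append_iff.1 h1
    obtain ⟨⟨_, a⟩, L3, rfl, rfl, h3⟩ := List.map_eq_cons_iff.1 h2
    obtain ⟨⟨j', b⟩, L4, rfl, rfl, h4⟩ := List.map_eq_cons_iff.1 h3
    obtain ⟨⟨i', c⟩, L5, rfl, h0, h5⟩ := List.map_eq_cons_iff.1 h4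
    obtain rfl := List.map_eq_nil_iff.1 h5
    dsimp only at h0 h
    subst h0
    let s : C(P, PosReal) := ⟨_, continuous_add_posReal a c⟩
    refine ⟨LA ++ [(j', ⟨_, continuous_mul_div b c s⟩), (i', s),
      (j', ⟨_, continuous_mul_div a b s⟩)] ++ LB, by simp, fun p => ?_⟩
    simpa [evalAt, s] using LusztigMove.braid (evalAt p LA) (evalAt p LB) _ _ (a p) (b p) (c p) h
  | comm A B i j h =>
    obtain ⟨L1, LB, rfl, h1, rfl⟩ := List.map_eq_append_iff.1 hL
    obtain ⟨LA, L2, rfl, rfl, h2⟩ := List.map_eq_append_iff.1 h1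
    obtain ⟨⟨i', a⟩, L3, rfl, rfl, h3⟩ := List.map_eq_cons_iff.1 h2
    obtain ⟨⟨j', b⟩, L4, rfl, rfl, h4⟩ := List.map_eq_cons_iff.1 h3
    obtain rfl := List.map_eq_nil_iff.1 h4
    refine ⟨LA ++ [(j', b), (i', a)] ++ LB, by simp, fun p => ?_⟩
    simpa [evalAt] using LusztigMove.comm (evalAt p LA) (evalAt p LB) _ _ (a p) (b p) h

/-- Weights can be carried along a sequence of moves between words, and the new weights depend
continuously on the old ones. -/
theorem MoveEquiv.exists_family {P : Type*} [TopologicalSpace P] {w w' : List (ZMod n)}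
    (h : MoveEquiv n w w') (L : List (ZMod n × C(P, PosReal))) (hL : L.map Prod.fst = w) :
    ∃ L' : List (ZMod n × C(P, PosReal)), L'.map Prod.fst = w' ∧
      ∀ p, Moves n (evalAt p L) (evalAt p L') := by
  induction h with
  | refl => exact ⟨L, hL, fun _ => .refl⟩
  | tail _ h ih =>
    obtain ⟨L1, h1, m1⟩ := ih
    obtain ⟨L2, h2, m2⟩ := h.exists_family L1 h1
    exact ⟨L2, h2, fun p => (m1 p).tail (m2 p)⟩

theorem MoveEquiv.exists_moves {w w' : List (ZMod n)} (h : MoveEquiv n w w')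
    (X : List (ZMod n × PosReal)) (hX : X.map Prod.fst = w) :
    ∃ Y : List (ZMod n × PosReal), Y.map Prod.fst = w' ∧
      Moves n X Y := by
  obtain ⟨L, h1, h2⟩ := h.exists_family (P := Unit)
    (X.map fun q => (q.1, ContinuousMap.const _ q.2)) (by simp [← hX])
  refine ⟨evalAt () L, by simp [evalAt, ← h1], ?_⟩
  have e : evalAt () (X.map fun q => (q.1, ContinuousMap.const Unit q.2)) = X := by
    simp [evalAt, Function.comp_def]
  rw [← e]
  exact h2 ()

/-- The automorphism `s_i ↦ s_{i + k}` on weighted words. -/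
def shiftWord (k : ZMod n) (X : List (ZMod n × PosReal)) : List (ZMod n × PosReal) :=
  X.map fun q => (q.1 + k, q.2)

@[simp] theorem shiftWord_append (k : ZMod n) (X Y : List (ZMod n × PosReal)) :
    shiftWord k (X ++ Y) = shiftWord k X ++ shiftWord k Y := by
  simp [shiftWord]

@[simp] theorem map_fst_shiftWord (k : ZMod n) (X : List (ZMod n × PosReal)) :
    (shiftWord k X).map Prod.fst = (X.map Prod.fst).map (· + k) := by
  simp [shiftWord]

@[simp] theorem shiftWord_weightedWord (w : List (ZMod n)) (k k' : ZMod n) (y : Weights w) :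
    shiftWord k (weightedWord w k' y) = weightedWord w (k' + k) y := by
  simp [shiftWord, weightedWord, List.map_ofFn, Function.comp_def, add_assoc]

@[simp] theorem map_fst_weightedWord (w : List (ZMod n)) (k : ZMod n) (y : Weights w) :
    (weightedWord w k y).map Prod.fst = w.map (· + k) := by
  apply List.ext_getElem <;> simp [weightedWord]

theorem weightedWord_injective (w : List (ZMod n)) (k : ZMod n) :
    Function.Injective (weightedWord w k) := by
  intro y y' h
  funext t
  have := congrFun (List.ofFn_injective h) t
  simpa using this

theorem exists_weights_family {P : Type*} [TopologicalSpace P] {w : List (ZMod n)} {k : ZMod n}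
    (L : List (ZMod n × C(P, PosReal))) (hL : L.map Prod.fst = w.map (· + k)) :
    ∃ Z : P → Weights w, Continuous Z ∧ ∀ p, evalAt p L = weightedWord w k (Z p) := by
  have hlen : L.length = w.length := by simpa using congrArg List.length hL
  refine ⟨fun p t => (L.get (t.cast hlen.symm)).2 p,
    continuous_pi fun t => ContinuousMap.continuous _, fun p => ?_⟩
  apply List.ext_getElem
  · simp [evalAt, weightedWord, hlen]
  · intro t h1 h2
    have ht : t < L.length := by simpa [evalAt] using h1
    have e : (L.map Prod.fst)[t]'(by simpa using ht) =
        (w.map (· + k))[t]'(by simpa [← hlen] using ht) := by simp only [hL]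
    simp only [List.getElem_map] at e
    simp [evalAt, weightedWord, e]

theorem exists_weights {w : List (ZMod n)} {k : ZMod n} (X : List (ZMod n × PosReal))
    (hX : X.map Prod.fst = w.map (· + k)) : ∃ y : Weights w, X = weightedWord w k y := by
  obtain ⟨Z, -, h⟩ := exists_weights_family (P := Unit)
    (X.map fun q => (q.1, ContinuousMap.const _ q.2)) (w := w) (k := k)
    (by rw [← hX]; simp)
  refine ⟨Z (), ?_⟩
  rw [← h ()]
  simp [evalAt, Function.comp_def]

theorem LusztigMove.shift {X Y : List (ZMod n × PosReal)} (h : LusztigMove n X Y) (k : ZMod n) :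
    LusztigMove n (shiftWord k X) (shiftWord k Y) := by
  have hM : ∀ i j, affineMatrix n (i + k) (j + k) = affineMatrix n i j := by
    intro i j
    have h1 : ∀ a b : ZMod n, a + k = b + k + 1 ↔ a = b + 1 := fun a b => by
      rw [add_right_comm]; exact add_left_inj k
    simp only [affineMatrix, Matrix.of_apply, add_left_inj, h1]
  cases h with
  | braid A B i j a b c h =>
    simpa [shiftWord] using LusztigMove.braid (shiftWord k A) (shiftWord k B) (i + k) (j + k) a b c
      ((hM i j).trans h)
  | comm A B i j a b h =>
    simpa [shiftWord] using LusztigMove.comm (shiftWord k A) (shiftWord k B) (i + k) (j + k) a b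
      ((hM i j).trans h)

theorem LusztigMove.append {X Y : List (ZMod n × PosReal)} (h : LusztigMove n X Y)
    (A B : List (ZMod n × PosReal)) : LusztigMove n (A ++ X ++ B) (A ++ Y ++ B) := by
  cases h with
  | braid A' B' i j a b c h =>
    simpa using LusztigMove.braid (A ++ A') (B' ++ B) i j a b c h
  | comm A' B' i j a b h =>
    simpa using LusztigMove.comm (A ++ A') (B' ++ B) i j a b h

theorem Moves.shift {X Y : List (ZMod n × PosReal)} (h : Moves n X Y) (k : ZMod n) :
    Moves n (shiftWord k X) (shiftWord k Y) :=
  Relation.ReflTransGen.lift (shiftWord k) (fun _ _ h => LusztigMove.shift h k) _ _ h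

theorem Moves.append {X Y : List (ZMod n × PosReal)} (h : Moves n X Y)
    (A B : List (ZMod n × PosReal)) : Moves n (A ++ X ++ B) (A ++ Y ++ B) :=
  Relation.ReflTransGen.lift (fun X => A ++ X ++ B) (fun _ _ h => LusztigMove.append h A B) _ _ h

/-! ### Blocks of states -/

/-- The word `u ρ^{-k}(u) ⋯ ρ^{-(N-1)k}(u)` of `N` consecutive states. -/
def blockWord (u : List (ZMod n)) (k : ZMod n) : ℕ → List (ZMod n)
  | 0 => []
  | N + 1 => blockWord u k N ++ u.map (· + -(N * k))

/-- The weighted word formed by the states `y 0, …, y (N - 1)`. -/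
def block {u : List (ZMod n)} (k : ZMod n) (y : ℕ → Weights u) : ℕ → List (ZMod n × PosReal)
  | 0 => []
  | N + 1 => block k y N ++ weightedWord u (-(N * k)) (y N)

@[simp] theorem map_fst_block {u : List (ZMod n)} (k : ZMod n) (y : ℕ → Weights u) (N : ℕ) :
    (block k y N).map Prod.fst = blockWord u k N := by
  induction N with
  | zero => rfl
  | succ N ih => simp [block, blockWord, ih]

theorem block_congr {u : List (ZMod n)} (k : ZMod n) {y y' : ℕ → Weights u} {N : ℕ}
    (h : ∀ t < N, y t = y' t) : block k y N = block k y' N := by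
  induction N with
  | zero => rfl
  | succ N ih => rw [block, block, ih fun t ht => h t (by omega), h N (by omega)]

theorem block_succ_left {u : List (ZMod n)} (k : ZMod n) (y : ℕ → Weights u) (N : ℕ) :
    block k y (N + 1) =
      weightedWord u 0 (y 0) ++ shiftWord (-k) (block k (fun t => y (t + 1)) N) := by
  induction N with
  | zero => simp [block, shiftWord]
  | succ N ih =>
    rw [block, ih, block, shiftWord_append, shiftWord_weightedWord, List.append_assoc]
    congr 4
    push_cast; ring

theorem exists_block_family (u : List (ZMod n)) (k : ZMod n) (N : ℕ) :
    ∃ L : List (ZMod n × C(ℕ → Weights u, PosReal)), L.map Prod.fst = blockWord u k N ∧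
      ∀ y, evalAt y L = block k y N := by
  induction N with
  | zero => exact ⟨[], rfl, fun _ => rfl⟩
  | succ N ih =>
    obtain ⟨L, h1, h2⟩ := ih
    refine ⟨L ++ List.ofFn fun t : Fin u.length =>
      (u.get t + -(N * k), ⟨fun y => y N t, by fun_prop⟩), ?_, fun y => ?_⟩
    · rw [List.map_append, h1, blockWord]
      congr 1
      apply List.ext_getElem <;> simp
    · have : evalAt y (L ++ List.ofFn fun t : Fin u.length =>
          ((u.get t + -(N * k), ⟨fun y => y N t, by fun_prop⟩) :
            ZMod n × C(ℕ → Weights u, PosReal))) =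
          evalAt y L ++ weightedWord u (-(N * k)) (y N) := by
        simp [evalAt, weightedWord, List.map_ofFn, Function.comp_def]
      rw [this, h2, block]

/-- A carrier that passes `N` states one after the other passes the block formed by them. -/
theorem moves_block {u v : List (ZMod n)} {k₁ k₂ : ZMod n} {z : ℕ → Weights v}
    {y y' : ℕ → Weights u} (h : ∀ t, Interaction u v k₁ k₂ (z t) (y t) (y' t) (z (t + 1)))
    (N : ℕ) :
    Moves n (weightedWord v 0 (z 0) ++ block k₁ y N)
      (shiftWord k₂ (block k₁ y' N) ++ weightedWord v (-(N * k₁)) (z N)) := by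
  induction N with
  | zero => simpa [block, shiftWord] using Relation.ReflTransGen.refl
  | succ N ih =>
    have h1 := Moves.append ih [] (weightedWord u (-(N * k₁)) (y N))
    have h2 := Moves.append (Moves.shift (h N) (-(N * k₁))) (shiftWord k₂ (block k₁ y' N)) []
    simp only [shiftWord_append, shiftWord_weightedWord, List.append_nil, List.nil_append, zero_add,
      List.append_assoc] at h1 h2
    have e : -k₁ + -((N : ZMod n) * k₁) = -(((N + 1 : ℕ) : ZMod n) * k₁) := by push_cast; ring
    have e' : -((N : ZMod n) * k₁) + k₂ = k₂ + -((N : ZMod n) * k₁) := add_comm _ _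
    rw [e] at h2
    simp only [block, shiftWord_append, shiftWord_weightedWord, List.append_assoc, e']
    exact Relation.ReflTransGen.trans h1 h2

/-! ### Displacements of glides -/

/-- The displacement `affPerm w x - x` of the integers `x` of residue `p`. -/
def disp (w : List (ZMod n)) (p : ZMod n) : ℤ := affPerm w p.cast - p.cast

theorem affPerm_eq_add_disp (w : List (ZMod n)) (x : ℤ) :
    affPerm w x = x + disp w (x : ZMod n) := by
  have h := affPerm_add w (x : ZMod n).cast (x - (x : ZMod n).cast) (by simp)
  rw [add_sub_cancel] at h
  rw [disp, h]; ring

theorem disp_intCast (w : List (ZMod n)) (x : ℤ) : disp w (x : ZMod n) = affPerm w x - x := by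
  rw [affPerm_eq_add_disp]; ring

theorem disp_append (a b : List (ZMod n)) (p : ZMod n) :
    disp (a ++ b) p = disp b p + disp a (p + disp b p) := by
  obtain ⟨x, rfl⟩ := ZMod.intCast_surjective p
  rw [disp_intCast, affPerm_append, affPerm_eq_add_disp a, affPerm_eq_add_disp b]
  push_cast; ring

theorem disp_shift (w : List (ZMod n)) (k p : ZMod n) :
    disp (w.map (· + k)) p = disp w (p - k) := by
  obtain ⟨x, rfl⟩ := ZMod.intCast_surjective p
  obtain ⟨m, rfl⟩ := ZMod.intCast_surjective k
  have := affPerm_shift w (m : ZMod n) (x - m) m rfl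
  rw [sub_add_cancel] at this
  rw [disp_intCast, this, ← Int.cast_sub, disp_intCast]; ring

theorem abs_disp_le (w : List (ZMod n)) (p : ZMod n) : |disp w p| ≤ w.length := by
  obtain ⟨x, rfl⟩ := ZMod.intCast_surjective p
  rw [disp_intCast]
  induction w with
  | nil => simp
  | cons i w ih =>
    have h : |affSwap i (affPerm w x) - affPerm w x| ≤ 1 := by
      unfold affSwap; split_ifs <;> simp
    rw [affPerm_cons, List.length_cons]
    push_cast
    rw [abs_le] at *
    constructor <;> linarith [h.1, h.2, ih.1, ih.2]

theorem IsGlide.disp_cast {w : List (ZMod n)} {k : ZMod n} [Fact (1 < n)]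
    (h : IsGlide ((coxeter n).wordProd w) k) (p : ZMod n) : (disp w p : ZMod n) = k := by
  obtain ⟨x, rfl⟩ := ZMod.intCast_surjective p
  rw [disp_intCast, Int.cast_sub, affPerm_wires, h]; ring

theorem le_sub_of_lt_of_cast_eq {a b : ℤ} (h : a < b) (e : (a : ZMod n) = b) : n ≤ b - a :=
  Int.le_of_dvd (by omega) ((ZMod.intCast_eq_intCast_iff_dvd_sub a b n).1 e)

theorem noDoubleCross_of_disp {a b : List (ZMod n)} {k : ZMod n}
    (hb : ∀ p, (disp b p : ZMod n) = k)
    (h : ∀ p q, disp b q < disp b p → disp a (q + k) ≤ disp a (p + k)) :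
    NoDoubleCross (affPerm a) (affPerm b) := by
  intro x y hxy hlt
  rw [affPerm_eq_add_disp a, affPerm_eq_add_disp a]
  rw [affPerm_eq_add_disp b, affPerm_eq_add_disp b] at hlt ⊢
  have := h x y (by omega)
  simp only [Int.cast_add, hb]
  omega

theorem exists_pos_lt_cast_eq_sub [Fact (1 < n)] {p q : ZMod n} (hpq : p ≠ q) :
    ∃ r : ℤ, 0 < r ∧ r < n ∧ (r : ZMod n) = p - q := by
  have hn : (0 : ℤ) < n := by have := (Fact.out : 1 < n); omega
  obtain ⟨d, hd⟩ := ZMod.intCast_surjective (p - q)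
  refine ⟨d % n, ?_, Int.emod_lt_of_pos _ hn, by simp [hd]⟩
  refine lt_of_le_of_ne (Int.emod_nonneg _ hn.ne') fun h0 => ?_
  apply hpq
  rw [← sub_eq_zero, ← hd, ZMod.intCast_zmod_eq_zero_iff_dvd]
  exact Int.dvd_of_emod_eq_zero h0.symm

/-- If `u` displaces `p` further than `q`, it inverts two integers of these residues whose images
are less than `n` apart. As `v` may not turn such a pair back, the displacements of `v` cannot be
ordered the opposite way. -/
theorem disp_le_of_noDoubleCross [Fact (1 < n)] {u v : List (ZMod n)} {k₁ k₂ : ZMod n}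
    (hu : ∀ p, (disp u p : ZMod n) = k₁) (hv : ∀ p, (disp v p : ZMod n) = k₂)
    (h : NoDoubleCross (affPerm v) (affPerm u)) {p q : ZMod n} (hlt : disp u q < disp u p) :
    disp v (q + k₁) ≤ disp v (p + k₁) := by
  have hpq : p ≠ q := by rintro rfl; exact lt_irrefl _ hlt
  obtain ⟨r, h0, hrn, hr⟩ := exists_pos_lt_cast_eq_sub hpq
  obtain ⟨y, rfl⟩ := ZMod.intCast_surjective q
  have hd := le_sub_of_lt_of_cast_eq hlt (by rw [hu, hu])
  -- lifts of `p` and `q` whose images under `u` are at distance `r < n`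
  obtain ⟨x, hxdef⟩ : ∃ x : ℤ, x = y + disp u y - disp u p + r := ⟨_, rfl⟩
  have hx : (x : ZMod n) = p := by simp [hxdef, hu, hr]
  have hux : affPerm u x = affPerm u y + r := by
    rw [affPerm_eq_add_disp, affPerm_eq_add_disp, hx, hxdef]; ring
  have h1 := h x y (by omega) (by omega)
  rw [affPerm_eq_add_disp v, affPerm_eq_add_disp v (affPerm u x), affPerm_eq_add_disp u,
    affPerm_eq_add_disp u x, Int.cast_add, Int.cast_add, hu, hu, hx] at h1
  by_contra hcon
  have hd' := le_sub_of_lt_of_cast_eq (not_le.1 hcon) (by rw [hv, hv])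
  omega

/-! ### Wires -/

/-- Integers that are inverted by the affine permutation lie on wires that cross. -/
theorem wiresCross_of_inversion [Fact (1 < n)] {w : List (ZMod n)} {x y : ℤ} (hxy : x < y)
    (h : affPerm w y < affPerm w x) : WiresCross w (x : ZMod n) y := by
  induction w with
  | nil => simp at h; omega
  | cons i w ih =>
    by_cases hw : affPerm w y < affPerm w x
    · obtain ⟨a, j, b, rfl, e⟩ := ih hw
      exact ⟨i :: a, j, b, rfl, e⟩
    · have hne : affPerm w x ≠ affPerm w y := fun e => by
        have := affPerm_injective w e; omega
      obtain ⟨h1, h2⟩ := eq_succ_of_affSwap_lt (i := i) (x := affPerm w x) (y := affPerm w y)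
        (by omega) h
      refine ⟨[], i, w, rfl, ?_⟩
      rw [← affPerm_wires, ← affPerm_wires, h1, Int.cast_add, h2, Int.cast_one]

/-- In a reduced word crossing wires have different displacements, since a pair of
integers that is inverted at a crossing stays inverted. -/
theorem WiresCross.disp_ne [Fact (1 < n)] {w : List (ZMod n)} (hw : CrossRed w) {p q : ZMod n}
    (h : WiresCross w p q) : disp w p ≠ disp w q := by
  obtain ⟨a, i, b, rfl, e⟩ := h
  wlog hpq : toPerm n ((coxeter n).wordProd b) p = i ∧
      toPerm n ((coxeter n).wordProd b) q = i + 1 generalizing p q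
  · rcases Sym2.eq_iff.1 e with h1 | h1
    · exact absurd h1 hpq
    · exact (this (Sym2.eq_swap.trans e) ⟨h1.2, h1.1⟩).symm
  obtain ⟨I, hI⟩ := ZMod.intCast_surjective i
  set x := affPerm b.reverse I with hxdef
  set y := affPerm b.reverse (I + 1) with hydef
  have hbx : affPerm b x = I := affPerm_affPerm_reverse b I
  have hby : affPerm b y = I + 1 := affPerm_affPerm_reverse b (I + 1)
  have hx : (x : ZMod n) = p := by
    apply (toPerm n ((coxeter n).wordProd b)).injective
    rw [← affPerm_wires, hbx, hpq.1, hI]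
  have hy : (y : ZMod n) = q := by
    apply (toPerm n ((coxeter n).wordProd b)).injective
    rw [← affPerm_wires, hby, hpq.2, ← hI]; simp
  have h1 : affSwap i I = I + 1 := affSwap_of_eq hI
  have h2 : affSwap i (I + 1) = I := affSwap_succ_of_eq hI
  have hxy : x < y := by
    by_contra hlt
    have hne : x ≠ y := fun e => by rw [e] at hbx; omega
    have hib : CrossRed ([i] ++ b) := hw.of_append_right
    have := NoDoubleCross.of_crossRed hib y x (by omega) (by omega)
    simp only [hbx, hby, affPerm_cons, affPerm_nil, h1, h2] at this
    omega
  have hinv : affPerm (a ++ i :: b) y < affPerm (a ++ i :: b) x := by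
    rw [affPerm_append, affPerm_append]
    exact NoDoubleCross.of_crossRed hw x y hxy
      (by simp only [affPerm_cons, hbx, hby, h1, h2]; omega)
  rw [affPerm_eq_add_disp _ x, affPerm_eq_add_disp _ y, hx, hy] at hinv
  omega

/-- The crossing hypothesis in terms of displacements: wires that do not cross in `u` have parallel
courses in `v` as well. -/
theorem disp_eq_of_wiresCross [Fact (1 < n)] {u v : List (ZMod n)} {k₁ k₂ : ZMod n}
    (hu : ∀ p, (disp u p : ZMod n) = k₁) (hv : ∀ p, (disp v p : ZMod n) = k₂)
    (hred : CrossRed u) (hcross : ∀ p q : ZMod n, WiresCross (v ++ u) p q → WiresCross u p q)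
    {p q : ZMod n} (h : disp u p = disp u q) : disp v (p + k₁) = disp v (q + k₁) := by
  by_contra hne
  wlog hlt : disp v (q + k₁) < disp v (p + k₁) generalizing p q
  · exact this h.symm (Ne.symm hne) (lt_of_le_of_ne (not_lt.1 hlt) hne)
  have hpq : p ≠ q := by rintro rfl; exact lt_irrefl _ hlt
  have hd := le_sub_of_lt_of_cast_eq hlt (by rw [hv, hv])
  obtain ⟨r, h0, hrn, hr⟩ := exists_pos_lt_cast_eq_sub hpq.symm
  obtain ⟨x, rfl⟩ := ZMod.intCast_surjective p
  have hy : ((x + r : ℤ) : ZMod n) = q := by simp [hr]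
  have hc := wiresCross_of_inversion (w := v ++ u) (x := x) (y := x + r) (by omega) (by
    rw [affPerm_eq_add_disp, affPerm_eq_add_disp (v ++ u) x, disp_append, disp_append, hy, hu, hu]
    omega)
  rw [hy] at hc
  exact (hcross _ _ hc).disp_ne hred h

/-! ### Blocks and carriers -/

/-- The shifts in `blockWord` are such that all its `N` factors displace a residue alike. -/
theorem disp_blockWord {u : List (ZMod n)} {k : ZMod n} (hu : ∀ p, (disp u p : ZMod n) = k)
    (N : ℕ) (p : ZMod n) : disp (blockWord u k N) p = N * disp u (p + (N - 1) * k) := by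
  induction N generalizing p with
  | zero => simp [blockWord, disp]
  | succ N ih =>
    rw [blockWord, disp_append, ih, disp_shift, hu]
    have e : p + k + ((N : ZMod n) - 1) * k = p + N * k := by ring
    have e' : p + (((N + 1 : ℕ) : ZMod n) - 1) * k = p + N * k := by push_cast; ring
    rw [e, e', sub_neg_eq_add]
    push_cast; ring

/-- The data that the proof needs about the displacements of a reduced product `v u` of two
glides: the displacements of `v` are weakly ordered like those of `u`. -/
structure GlidePair (u v : List (ZMod n)) (k₁ k₂ : ZMod n) : Prop where
  disp_u : ∀ p, (disp u p : ZMod n) = k₁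
  disp_v : ∀ p, (disp v p : ZMod n) = k₂
  red_u : CrossRed u
  red_v : CrossRed v
  mono : ∀ p q, disp u q < disp u p → disp v (q + k₁) ≤ disp v (p + k₁)

namespace GlidePair

variable {u v : List (ZMod n)} {k₁ k₂ : ZMod n}

theorem disp_block (h : GlidePair u v k₁ k₂) (N : ℕ) (p : ZMod n) :
    (disp (blockWord u k₁ N) p : ZMod n) = N * k₁ := by
  rw [disp_blockWord h.disp_u]; simp [h.disp_u]

theorem affPerm_carrier_block (h : GlidePair u v k₁ k₂) (N : ℕ) :
    affPerm (v ++ blockWord u k₁ N) =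
      affPerm ((blockWord u k₁ N).map (· + k₂) ++ v.map (· + -(N * k₁))) := by
  funext x
  rw [affPerm_eq_add_disp, affPerm_eq_add_disp (_ ++ v.map _), disp_append, disp_append, disp_shift,
    disp_shift, h.disp_block, h.disp_v, disp_blockWord h.disp_u, disp_blockWord h.disp_u,
    sub_neg_eq_add, add_sub_cancel_right]
  ring

variable [Fact (1 < n)]

theorem red_block (h : GlidePair u v k₁ k₂) (N : ℕ) : CrossRed (blockWord u k₁ N) := by
  induction N with
  | zero => exact crossRed_nil
  | succ N ih =>
    refine crossRed_append ih (h.red_u.shift _) (noDoubleCross_of_disp (k := k₁)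
      (fun p => by rw [disp_shift, h.disp_u]) fun p q hlt => ?_)
    simp only [disp_shift, disp_blockWord h.disp_u] at hlt ⊢
    have e : ∀ p : ZMod n, p + k₁ + ((N : ZMod n) - 1) * k₁ = p - -(N * k₁) := fun p => by ring
    rw [e, e]
    gcongr

theorem red_carrier_block (h : GlidePair u v k₁ k₂) (N : ℕ) :
    CrossRed (v ++ blockWord u k₁ N) := by
  refine crossRed_append h.red_v (h.red_block N) (noDoubleCross_of_disp (h.disp_block N)
    fun p q hlt => ?_)
  rw [disp_blockWord h.disp_u, disp_blockWord h.disp_u] at hlt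
  have := h.mono _ _ (lt_of_mul_lt_mul_left hlt (by positivity))
  have e : ∀ p : ZMod n, p + ((N : ZMod n) - 1) * k₁ + k₁ = p + N * k₁ := fun p => by ring
  rwa [e, e] at this

theorem red_block_carrier (h : GlidePair u v k₁ k₂) (N : ℕ) :
    CrossRed ((blockWord u k₁ N).map (· + k₂) ++ v.map (· + -(N * k₁))) := by
  refine crossRed_append ((h.red_block N).shift _) (h.red_v.shift _) (noDoubleCross_of_disp
    (k := k₂) (fun p => by rw [disp_shift, h.disp_v]) fun p q hlt => ?_)
  simp only [disp_shift, disp_blockWord h.disp_u, add_sub_cancel_right] at hlt ⊢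
  refine mul_le_mul_of_nonneg_left ?_ (by positivity)
  by_contra hcon
  have := h.mono _ _ (not_le.1 hcon)
  have e : ∀ p : ZMod n, p + ((N : ZMod n) - 1) * k₁ + k₁ = p - -(N * k₁) := fun p => by ring
  rw [e, e] at this
  omega

/-- If residues with equal displacement under `u` have equal displacement under `v`, then a long
block of states has a reduced word that ends in the (shifted) carrier word. -/
theorem exists_word_before_carrier (h : GlidePair u v k₁ k₂)
    (htight : ∀ p q, disp u p = disp u q → disp v (p + k₁) = disp v (q + k₁)) {N : ℕ}
    (hN : 2 * v.length ≤ N) :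
    ∃ W : List (ZMod n), CrossRed (W ++ v.map (· + -(N * k₁))) ∧
      affPerm (W ++ v.map (· + -(N * k₁))) = affPerm (blockWord u k₁ N) := by
  set v' := v.map (· + -((N : ZMod n) * k₁)) with hv'
  obtain ⟨W, hW, -, e⟩ := exists_crossRed (blockWord u k₁ N ++ v'.reverse)
  have e' : ∀ x, affPerm W (affPerm v' x) = affPerm (blockWord u k₁ N) x := fun x => by simp [e]
  refine ⟨W, crossRed_append hW (h.red_v.shift _) fun x y hxy hlt => ?_, funext fun x => by
    rw [affPerm_append, e']⟩
  rw [e', e', affPerm_eq_add_disp, affPerm_eq_add_disp (blockWord _ _ _) x,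
    disp_blockWord h.disp_u, disp_blockWord h.disp_u]
  rw [affPerm_eq_add_disp, affPerm_eq_add_disp v' x, hv', disp_shift, disp_shift] at hlt
  have es : ∀ p : ZMod n, p - -(N * k₁) = p + ((N : ZMod n) - 1) * k₁ + k₁ := fun p => by ring
  rw [es, es] at hlt
  generalize (x : ZMod n) + ((N : ZMod n) - 1) * k₁ = p at *
  generalize (y : ZMod n) + ((N : ZMod n) - 1) * k₁ = q at *
  have h1 := abs_le.1 (abs_disp_le v (p + k₁))
  have h2 := abs_le.1 (abs_disp_le v (q + k₁))
  rcases lt_trichotomy (disp u p) (disp u q) with h3 | h3 | h3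
  · have := h.mono _ _ h3; omega
  · have := htight _ _ h3; omega
  · -- the gap `N` between the displacements of the block exceeds the distance `y - x`
    have : (N : ℤ) * (disp u q + 1) ≤ N * disp u p :=
      mul_le_mul_of_nonneg_left (by omega) (by positivity)
    rw [mul_add, mul_one] at this
    omega

theorem exists_interaction (h : GlidePair u v k₁ k₂) (z : Weights v) (y : Weights u) :
    ∃ y' z', Interaction u v k₁ k₂ z y y' z' := by
  have h1 := h.red_carrier_block 1
  have h2 := h.red_block_carrier 1
  have h3 := h.affPerm_carrier_block 1
  simp only [blockWord, Nat.cast_zero, Nat.cast_one, zero_mul, one_mul, neg_zero, add_zero,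
    List.map_id', List.nil_append] at h1 h2 h3
  obtain ⟨Y, hY, hm⟩ := (h1.moveEquiv h2 h3).exists_moves
    (weightedWord v 0 z ++ weightedWord u 0 y) (by simp)
  obtain ⟨Y1, Y2, rfl, e1, e2⟩ := List.map_eq_append_iff.1 hY
  obtain ⟨y', rfl⟩ := exists_weights Y1 e1
  obtain ⟨z', rfl⟩ := exists_weights Y2 e2
  exact ⟨y', z', hm⟩

theorem interaction_unique (h : GlidePair u v k₁ k₂) {z : Weights v} {y y' y'' : Weights u}
    {z' z'' : Weights v} (h1 : Interaction u v k₁ k₂ z y y' z')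
    (h2 : Interaction u v k₁ k₂ z y y'' z'') : y' = y'' ∧ z' = z'' := by
  have hr := h.red_block_carrier 1
  simp only [blockWord, Nat.cast_zero, Nat.cast_one, zero_mul, one_mul, neg_zero, add_zero,
    List.map_id', List.nil_append] at hr
  have e := (columns_eq_of_moves h1).symm.trans (columns_eq_of_moves h2)
  have := (weights_eq_of_columns_eq (X := []) (X' := [])
    (Z := weightedWord u k₂ y' ++ weightedWord v (-k₁) z')
    (Z' := weightedWord u k₂ y'' ++ weightedWord v (-k₁) z'')
    (by simpa using hr) (by simpa using hr) rfl (by simp) (by simp only [List.nil_append, e])).1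
  obtain ⟨a, b⟩ := List.append_inj this (by simp [weightedWord])
  exact ⟨weightedWord_injective _ _ a, weightedWord_injective _ _ b⟩

/-- The carrier that leaves a long block of states is a continuous function of the block. -/
theorem exists_carrier (h : GlidePair u v k₁ k₂) {N : ℕ} {W : List (ZMod n)}
    (hW : CrossRed (W ++ v.map (· + -(N * k₁))))
    (hperm : affPerm (W ++ v.map (· + -(N * k₁))) = affPerm (blockWord u k₁ N)) :
    ∃ Z : (ℕ → Weights u) → Weights v, Continuous Z ∧ ∀ y, ∃ X : List (ZMod n × PosReal),
      X.map Prod.fst = W ∧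
        Moves n (block k₁ y N) (X ++ weightedWord v (-(N * k₁)) (Z y)) := by
  obtain ⟨L, h1, h2⟩ := exists_block_family u k₁ N
  obtain ⟨L', h3, h4⟩ := ((h.red_block N).moveEquiv hW hperm.symm).exists_family L h1
  obtain ⟨L1, L2, rfl, e1, e2⟩ := List.map_eq_append_iff.1 h3
  obtain ⟨Z, hZ, e3⟩ := exists_weights_family L2 e2
  refine ⟨Z, hZ, fun y => ⟨evalAt y L1, by simp [evalAt, ← e1], ?_⟩⟩
  have := h4 y
  rwa [h2, evalAt, List.map_append, ← evalAt, ← evalAt, e3] at this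

variable {N : ℕ} {W : List (ZMod n)} {Z : (ℕ → Weights u) → Weights v}

theorem carrier_congr (hW : CrossRed (W ++ v.map (· + -(N * k₁))))
    (hZ : ∀ y, ∃ X : List (ZMod n × PosReal), X.map Prod.fst = W ∧
      Moves n (block k₁ y N) (X ++ weightedWord v (-(N * k₁)) (Z y)))
    {y y' : ℕ → Weights u} (hy : ∀ t < N, y t = y' t) : Z y = Z y' := by
  obtain ⟨X, e, m⟩ := hZ y
  obtain ⟨X', e', m'⟩ := hZ y'
  rw [← block_congr k₁ hy] at m'
  refine weightedWord_injective v _ (weights_eq_of_columns_eq (X := X) (X' := X')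
    (by simpa [e] using hW) (by simpa [e'] using hW) (by rw [e, e']) (by simp) ?_).1
  rw [← columns_eq_of_moves m, ← columns_eq_of_moves m']

/-- A carrier that has passed a long block of states is the carrier computed from the block: the
carrier before the block does not matter. -/
theorem carrier_of_sweep (h : GlidePair u v k₁ k₂) (hW : CrossRed (W ++ v.map (· + -(N * k₁))))
    (hperm : affPerm (W ++ v.map (· + -(N * k₁))) = affPerm (blockWord u k₁ N))
    (hZ : ∀ y, ∃ X : List (ZMod n × PosReal), X.map Prod.fst = W ∧
      Moves n (block k₁ y N) (X ++ weightedWord v (-(N * k₁)) (Z y)))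
    {z : ℕ → Weights v} {y y' : ℕ → Weights u}
    (hs : ∀ t, Interaction u v k₁ k₂ (z t) (y t) (y' t) (z (t + 1))) : z N = Z y := by
  obtain ⟨X, e, m⟩ := hZ y
  have m1 := moves_block hs N
  have m2 := Moves.append m (weightedWord v 0 (z 0)) []
  simp only [List.append_nil] at m2
  rw [← List.append_assoc] at m2
  have hred : CrossRed (v ++ (W ++ v.map (· + -(N * k₁)))) := by
    have := crossRed_append_iff.1 (h.red_carrier_block N)
    exact crossRed_append this.1 hW (by rw [hperm]; exact this.2.2)
  have hX : affPerm ((blockWord u k₁ N).map (· + k₂)) = affPerm (v ++ W) := by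
    apply affPerm_append_right_cancel (c := v.map (· + -((N : ZMod n) * k₁)))
    rw [← h.affPerm_carrier_block N, List.append_assoc]
    funext x
    rw [affPerm_append, affPerm_append v, hperm]
  refine weightedWord_injective v _ (weights_eq_of_columns_eq
    (X := shiftWord k₂ (block k₁ y' N)) (X' := weightedWord v 0 (z 0) ++ X)
    (by simpa using h.red_block_carrier N) (by simpa [e] using hred) (by simpa [e] using hX)
    (by simp) ?_).1
  rw [← columns_eq_of_moves m1, ← columns_eq_of_moves m2]

/-- The carriers computed from the blocks of states before them fit together. -/
theorem interaction_carrier (h : GlidePair u v k₁ k₂)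
    (hW : CrossRed (W ++ v.map (· + -(N * k₁))))
    (hperm : affPerm (W ++ v.map (· + -(N * k₁))) = affPerm (blockWord u k₁ N))
    (hZ : ∀ y, ∃ X : List (ZMod n × PosReal), X.map Prod.fst = W ∧
      Moves n (block k₁ y N) (X ++ weightedWord v (-(N * k₁)) (Z y)))
    {y : ℕ → Weights u} {y' : Weights u} {z' : Weights v}
    (hs : Interaction u v k₁ k₂ (Z y) (y N) y' z') : z' = Z fun t => y (t + 1) := by
  obtain ⟨X, e, m⟩ := hZ y
  obtain ⟨X', e', m'⟩ := hZ fun t => y (t + 1)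
  have ek : -k₁ + -((N : ZMod n) * k₁) = -(((N + 1 : ℕ) : ZMod n) * k₁) := by push_cast; ring
  have ek' : -((N : ZMod n) * k₁) + -k₁ = -(((N + 1 : ℕ) : ZMod n) * k₁) := by push_cast; ring
  -- the last of `N + 1` states is passed by the carrier of the first `N`
  have m1 : Moves n (block k₁ y (N + 1)) (X ++ weightedWord u (k₂ + -(N * k₁)) y' ++
      weightedWord v (-((N + 1 : ℕ) * k₁)) z') := by
    have a1 := Moves.append m [] (weightedWord u (-(N * k₁)) (y N))
    have a2 := Moves.append (Moves.shift hs (-(N * k₁))) X []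
    simp only [shiftWord_append, shiftWord_weightedWord, List.append_nil, List.nil_append, zero_add,
      List.append_assoc, ek] at a1 a2
    rw [List.append_assoc]
    exact Relation.ReflTransGen.trans a1 a2
  -- alternatively, the carrier is computed from the last `N` states
  have m2 : Moves n (block k₁ y (N + 1)) (weightedWord u 0 (y 0) ++ shiftWord (-k₁) X' ++
      weightedWord v (-((N + 1 : ℕ) * k₁)) (Z fun t => y (t + 1))) := by
    have a1 := Moves.append (Moves.shift m' (-k₁)) (weightedWord u 0 (y 0)) []
    simp only [shiftWord_append, shiftWord_weightedWord, List.append_nil, ek'] at a1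
    rw [block_succ_left, List.append_assoc]
    exact a1
  set u' := u.map (· + -((N : ZMod n) * k₁)) with hu'
  set v' := v.map (· + -((N : ZMod n) * k₁)) with hv'
  set u₂ := u.map (· + (k₂ + -((N : ZMod n) * k₁))) with hu₂
  set v₂ := v.map (· + -(((N + 1 : ℕ) : ZMod n) * k₁)) with hv₂
  have hblock : blockWord u k₁ (N + 1) = u ++ (blockWord u k₁ N).map (· + -k₁) := by
    rw [← map_fst_block k₁ y, block_succ_left]; simp
  have hredN := h.red_block (N + 1)
  have hvu : CrossRed (u₂ ++ v₂) ∧ affPerm (v' ++ u') = affPerm (u₂ ++ v₂) := by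
    have e1 := affPerm_map_add_congr (h.affPerm_carrier_block 1) (-((N : ZMod n) * k₁))
    have e2 := (h.red_block_carrier 1).shift (-((N : ZMod n) * k₁))
    simp only [blockWord, Nat.cast_zero, Nat.cast_one, zero_mul, one_mul, neg_zero, add_zero,
      List.map_id', List.nil_append, List.map_append, List.map_map, Function.comp_def, add_assoc,
      ek] at e1 e2
    exact ⟨e2, e1⟩
  have hperm1 : affPerm (W ++ u₂ ++ v₂) = affPerm (blockWord u k₁ (N + 1)) := by
    funext x
    rw [List.append_assoc, affPerm_append, ← hvu.2, ← affPerm_append, ← List.append_assoc,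
      affPerm_append, hperm, blockWord, affPerm_append]
  have hsh : (W ++ v').map (· + -k₁) = W.map (· + -k₁) ++ v₂ := by
    simp only [List.map_append, hv', hv₂, List.map_map, Function.comp_def, add_assoc, ek']
  have hperm2 : affPerm (u ++ W.map (· + -k₁) ++ v₂) = affPerm (blockWord u k₁ (N + 1)) := by
    rw [List.append_assoc, ← hsh, hblock]
    funext x
    rw [affPerm_append, affPerm_append, affPerm_map_add_congr hperm]
  have hred1 : CrossRed (W ++ u₂ ++ v₂) := by
    have h1 : CrossRed (W ++ v' ++ u') := by
      rw [blockWord] at hredN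
      have := crossRed_append_iff.1 hredN
      exact crossRed_append hW this.2.1 (by rw [hperm]; exact this.2.2)
    rw [List.append_assoc] at h1 ⊢
    have := crossRed_append_iff.1 h1
    exact crossRed_append this.1 hvu.1 (by rw [← hvu.2]; exact this.2.2)
  have hred2 : CrossRed (u ++ W.map (· + -k₁) ++ v₂) := by
    rw [List.append_assoc, ← hsh]
    rw [hblock] at hredN
    have := crossRed_append_iff.1 hredN
    exact crossRed_append this.1 (hW.shift _) (by
      rw [affPerm_map_add_congr hperm]; exact this.2.2)
  refine weightedWord_injective v (-((N + 1 : ℕ) * k₁)) (weights_eq_of_columns_eq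
    (X := X ++ weightedWord u (k₂ + -(N * k₁)) y')
    (X' := weightedWord u 0 (y 0) ++ shiftWord (-k₁) X') ?_ ?_ ?_ (by simp) ?_).1
  · simpa [e, hu₂, hv₂] using hred1
  · simpa [e', hv₂] using hred2
  · have := affPerm_append_right_cancel (hperm1.trans hperm2.symm)
    simpa [e, e'] using this
  · rw [← columns_eq_of_moves m1, ← columns_eq_of_moves m2]

end GlidePair
end AffineDKdV

/-! ### The carrier-free description -/

/-- If every pair of wires that crosses in the diagram of `v u` already crosses in `u`, then affine
dKdV has a carrier free description: there is a local rule `G`, depending on the two words only,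
that computes the new states of every two-sided sweep; in particular it computes the time
evolution for every vacuum `w` and every initial carrier `z₀` compatible with it. -/
theorem theorem9p1 (n : ℕ) (hn : 2 ≤ n) (u v : List (ZMod n)) (k₁ k₂ : ZMod n)
    (hu : IsGlide ((coxeter n).wordProd u) k₁)
    (hv : IsGlide ((coxeter n).wordProd v) k₂)
    (hred : (coxeter n).IsReduced (v ++ u))
    (hcross : ∀ p q : ZMod n, WiresCross (v ++ u) p q → WiresCross u p q) :
    ∃ (r : ℕ) (G : (Fin (r + 1) → Weights u) → Weights u),
      (∀ y y' : ℤ → Weights u, (∃ z, Sweep u v k₁ k₂ z y y') ↔ IsGivenBy G y y') ∧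
      (∀ (w : Weights u) (z₀ : Weights v), Interaction u v k₁ k₂ z₀ w w z₀ →
        ∀ y : ℤ → Weights u, Tendsto y atBot (𝓝 w) → Tendsto y atTop (𝓝 w) →
          ∀ y' : ℤ → Weights u, Evolves u v k₁ k₂ z₀ y y' ↔ IsGivenBy G y y') := by
  have : Fact (1 < n) := ⟨hn⟩
  have hdu := hu.disp_cast
  have hdv := hv.disp_cast
  obtain ⟨rv, ru, hnd⟩ := crossRed_append_iff.1 (crossRed_of_isReduced hred)
  have hgp : GlidePair u v k₁ k₂ :=
    ⟨hdu, hdv, ru, rv, fun _ _ h => disp_le_of_noDoubleCross hdu hdv hnd h⟩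
  obtain ⟨W, hW, hperm⟩ := hgp.exists_word_before_carrier
    (fun _ _ h => disp_eq_of_wiresCross hdu hdv ru hcross h) le_rfl
  obtain ⟨Z, hZc, hZ⟩ := hgp.exists_carrier hW hperm
  generalize 2 * v.length = N at *
  choose F₁ F₂ hF using hgp.exists_interaction
  -- the states from the one `N` steps before the `i`-th on
  let win (y : ℤ → Weights u) (i : ℤ) (t : ℕ) : Weights u := y (i - N + t)
  let ext (s : Fin (N + 1) → Weights u) (t : ℕ) : Weights u :=
    if h : t < N + 1 then s ⟨t, h⟩ else s 0
  let G (s : Fin (N + 1) → Weights u) : Weights u := F₁ (Z (ext s)) (s (Fin.last N))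
  have hG : ∀ y i, (G fun t => y (i - N + ((t : ℕ) : ℤ))) = F₁ (Z (win y i)) (y i) := by
    intro y i
    have h1 : Z (ext fun t => y (i - N + ((t : ℕ) : ℤ))) = Z (win y i) := by
      refine GlidePair.carrier_congr hW hZ fun t ht => ?_
      have ht' : t < N + 1 := by omega
      simp only [ext, win, dif_pos ht']
    simp only [G, h1, Fin.val_last, sub_add_cancel]
  have hcarrier : ∀ {z : ℤ → Weights v} {y y' : ℤ → Weights u}, Sweep u v k₁ k₂ z y y' →
      ∀ i, z i = Z (win y i) := by
    intro z y y' hs i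
    have := hgp.carrier_of_sweep hW hperm hZ (z := fun t => z (i - N + t))
      (y := win y i) (y' := fun t => y' (i - N + t))
      fun t => by
        have := hs (i - N + t)
        rwa [add_assoc] at this
    simpa using this
  have hiff : ∀ y y' : ℤ → Weights u, (∃ z, Sweep u v k₁ k₂ z y y') ↔ IsGivenBy G y y' := by
    intro y y'
    constructor
    · rintro ⟨z, hs⟩ i
      rw [hG, ← hcarrier hs i]
      exact (hgp.interaction_unique (hs i) (hF _ _)).1
    · intro h
      refine ⟨fun i => Z (win y i), fun i => ?_⟩
      have h1 := hF (Z (win y i)) (y i)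
      have h2 : y i = win y i N := by simp [win]
      have h3 := hgp.interaction_carrier hW hperm hZ (y := win y i) (by rw [← h2]; exact h1)
      have h4 : (fun t => win y i (t + 1)) = win y (i + 1) := by
        funext t
        simp only [win]
        congr 1
        push_cast; ring
      rw [h3, h4] at h1
      rwa [h i, hG]
  refine ⟨N, G, hiff, fun w z₀ hvac y hbot _ y' => ⟨fun ⟨z, _, hs⟩ => (hiff y y').1 ⟨z, hs⟩,
    fun h => ?_⟩⟩
  obtain ⟨z, hs⟩ := (hiff y y').2 h
  refine ⟨z, ?_, hs⟩
  -- the constant sweep through the vacuum identifies the limit of the carriers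
  have hz₀ : z₀ = Z fun _ => w :=
    hcarrier (z := fun _ => z₀) (y := fun _ => w) (y' := fun _ => w) (fun _ => hvac) 0
  rw [hz₀, funext (hcarrier hs)]
  refine (hZc.tendsto _).comp (tendsto_pi_nhds.2 fun t => hbot.comp ?_)
  exact tendsto_atBot_add_const_right _ _
    (tendsto_atBot_add_const_right _ (-(N : ℤ)) tendsto_id)
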